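/- **Setting.** A conjunctive query with arithmetic comparisons (CQAC) $Q$ consists of a head (a tuple of terms), finitely many relational subgoals, and a finite set $\beta$ of arithmetic comparisons (ACs) $X\,\theta\,Y$ with $\theta\in\{<,\le,>,\ge,=,\ne\}$, $X$ a variable and $Y$ a variable or a constant. Values are taken from a dense linear order without endpoints that contains the rationals (e.g. $\mathbb Q$ or $\mathbb R$); constants are rational numbers, encoded in binary. Queries are safe (all variables of the head and of the ACs occur in relational subgoals), and the ACs of each query are consistent. $Q_2\sqsubseteq Q_1$ means $Q_2(D)\subseteq Q_1(D)$ for every finite database $D$. An LSI is an AC $X\le c$ (closed) or $X<c$ (open), an RSI is an AC $X\ge c$ (closed) or $X>c$ (open), with $c$ a constant. The closure of a set of ACs is the set of all ACs that it implies. We say that $X$ and $c$ are related by the closed LSI $X\le c$ in $Q_2$ if $X\le c$ is in the closure of the ACs of $Q_2$ while $X<c$ and $X=c$ are not, and likewise for the closed RSI $X\ge c$. The normalized form of $Q$ contains no equation introduced by normalization if the terms in the head and the relational subgoals of $Q$ are pairwise distinct variables (no repeated variable, no constant). **Theorem.** Let $Q_2$ range over all CQACs (with any ACs), and let $Q_1$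 range over the CQACs all of whose ACs are of one of the following types: 1. closed LSIs and at most one closed RSI; 2. closed LSIs and at most one open RSI; 3. open LSIs and at most one closed RSI; 4. open LSIs and at most one open RSI. Suppose that the pair $(Q_1,Q_2)$ satisfies the following conditions. (a) For any AC $X\neq Y$ of $Q_2$ between two variables and any constant $c_0$: either $c_0$ is not related to both $X$ and $Y$ by closed semi-interval ACs (LSI or RSI) in $Q_2$, or $c_0$ does not appear in an open AC of $Q_1$. (b) If $Q_2$ has an AC $X\ne Y$ between two variables, then no constant appears both in an open LSI and in an open RSI of $Q_1$ (automatic in cases 1–3). (c) If the normalization of $Q_1$ introduces an equation, then no constant of an open LSI of $Q_1$ appears in an open RSI of $Q_1$, or relates to a variable by a closed LSI in $Q_2$ (automatic in cases 1 and 2). Then, in each of the four cases, the following problem is in NP: given such a pair $(Q_1,Q_2)$, determine whether $Q_2\sqsubseteq Q_1$. That is, there is a language in NP that contains the encoding of such a pair if and only if $Q_2\sqsubseteq Q_1$. -/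

import Mathlib

/-! ### A cost-counting machine model and the class NP -/

namespace Machine

/-- Machine data: binary trees whose leaves are integers (written in binary). -/
inductive Data where
  | int (n : ℤ) : Data
  | pair (a b : Data) : Data
  deriving DecidableEq

/-- The size of a datum: number of nodes plus the total bit length of the leaves. -/
def Data.size : Data → ℕ
  | .int n => 1 + n.natAbs.size
  | .pair a b => 1 + a.size + b.size

/-- Elementary operations. -/
inductive Prim where
  | id | fst | snd | isPair | eq | le | add | sub | mul

/-- The result of an elementary operation.  Truth values are `0` (false) and `1` (true); an
operation that is applied to a datum of the wrong shape returns `0`. -/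
def Prim.eval : Prim → Data → Data
  | .id, x => x
  | .fst, .pair a _ => a
  | .snd, .pair _ b => b
  | .isPair, .pair _ _ => .int 1
  | .eq, .pair a b => if a = b then .int 1 else .int 0
  | .le, .pair (.int m) (.int n) => if m ≤ n then .int 1 else .int 0
  | .add, .pair (.int m) (.int n) => .int (m + n)
  | .sub, .pair (.int m) (.int n) => .int (m - n)
  | .mul, .pair (.int m) (.int n) => .int (m * n)
  | _, _ => .int 0

/-- Programs: elementary operations, constants, pairing of two results, sequential composition
(`comp g f` runs `f`, then `g`), branching, and while loops (`loop c f` repeats `f` as long as the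
test `c` returns something other than `0`). -/
inductive Prog where
  | prim (o : Prim) : Prog
  | const (d : Data) : Prog
  | pair (f g : Prog) : Prog
  | comp (g f : Prog) : Prog
  | ite (c f g : Prog) : Prog
  | loop (c f : Prog) : Prog

/-- `Runs p x y t`: on input `x` the program `p` halts with output `y` after time `t`.  Every step
is charged for the size of all data that it reads, copies or writes (logarithmic cost), so that
this notion of time is polynomially equivalent to the running time of Turing machines. -/
inductive Runs : Prog → Data → Data → ℕ → Prop where
  | prim (o : Prim) (x : Data) :
      Runs (.prim o) x (o.eval x) (1 + x.size + (o.eval x).size)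
  | const (d x : Data) :
      Runs (.const d) x d (1 + d.size)
  | pair {f g : Prog} {x y z : Data} {s t : ℕ} :
      Runs f x y s → Runs g x z t →
      Runs (.pair f g) x (.pair y z) (s + t + 1 + x.size + y.size + z.size)
  | comp {f g : Prog} {x y z : Data} {s t : ℕ} :
      Runs f x y s → Runs g y z t →
      Runs (.comp g f) x z (s + t + 1)
  | iteTrue {c f g : Prog} {x b y : Data} {s t : ℕ} :
      Runs c x b s → b ≠ .int 0 → Runs f x y t →
      Runs (.ite c f g) x y (s + t + 1 + x.size)
  | iteFalse {c f g : Prog} {x y : Data} {s t : ℕ} :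
      Runs c x (.int 0) s → Runs g x y t →
      Runs (.ite c f g) x y (s + t + 1 + x.size)
  | loopStop {c f : Prog} {x : Data} {s : ℕ} :
      Runs c x (.int 0) s →
      Runs (.loop c f) x x (s + 1 + x.size)
  | loopStep {c f : Prog} {x b y z : Data} {s t u : ℕ} :
      Runs c x b s → b ≠ .int 0 → Runs f x y t → Runs (.loop c f) y z u →
      Runs (.loop c f) x z (s + t + u + 1 + x.size)

/-- The class NP of languages: there are a verifier `V`, a polynomial bound `p` on the length of
certificates and a polynomial bound `q` on the running time, such that `V` halts within time
`q` on every input with every certificate of admissible length, and `x` belongs to the language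
iff `V` returns `1` on `x` with some certificate of admissible length. -/
def NP (L : Set Data) : Prop :=
  ∃ (V : Prog) (p q : Polynomial ℕ),
    (∀ x y : Data, y.size ≤ p.eval x.size →
      ∃ r t, Runs V (.pair x y) r t ∧ t ≤ q.eval x.size) ∧
    ∀ x : Data, x ∈ L ↔
      ∃ y : Data, y.size ≤ p.eval x.size ∧ ∃ t, Runs V (.pair x y) (.int 1) t

/-- A decision problem: a set of instances, presented to the machine through an encoding, and the
set of yes-instances. -/
structure DecisionProblem where
  Inst : Type
  enc : Inst → Data
  yes : Inst → Prop

/-- A decision problem is in NP if some language in NP gives the right answer on every instance. -/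
def DecisionProblem.InNP (P : DecisionProblem) : Prop :=
  ∃ L : Set Data, NP L ∧ ∀ I : P.Inst, P.enc I ∈ L ↔ P.yes I

end Machine

/-! ### Conjunctive queries with arithmetic comparisons -/

namespace CQAC

open Machine (Data DecisionProblem)

/-- Terms: variables (named by natural numbers) and constants (rational numbers). -/
inductive Term where
  | var (n : ℕ) : Term
  | const (c : ℚ) : Term

/-- A relational atom.  A relation is identified by its name together with its arity. -/
structure Atom where
  rel : ℕ
  args : List Term

/-- The comparison symbols `<`, `≤`, `>`, `≥`, `=`, `≠`. -/
inductive CompOp where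
  | lt | le | gt | ge | eq | ne

/-- An arithmetic comparison (AC) `X θ Y`: `X` is a variable, `Y` a variable or a constant. -/
structure AC where
  lhs : ℕ
  op : CompOp
  rhs : Term

/-- A conjunctive query with arithmetic comparisons: the terms of the head, the relational
subgoals, and the arithmetic comparisons. -/
structure Query where
  head : List Term
  body : List Atom
  acs : List AC

section Semantics

variable {D : Type*} [LinearOrder D] (ι : ℚ ↪o D)

/-- The value of a term under an assignment of the variables; `ι` interprets the constants. -/
def Term.eval (v : ℕ → D) : Term → D
  | .var n => v n
  | .const c => ι c

/-- The order relation denoted by a comparison symbol. -/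
def CompOp.Rel : CompOp → D → D → Prop
  | .lt, a, b => a < b
  | .le, a, b => a ≤ b
  | .gt, a, b => a > b
  | .ge, a, b => a ≥ b
  | .eq, a, b => a = b
  | .ne, a, b => a ≠ b

/-- Truth of an arithmetic comparison under an assignment. -/
def AC.Holds (v : ℕ → D) (a : AC) : Prop :=
  a.op.Rel (v a.lhs) (a.rhs.eval ι v)

/-- A fact over the domain `D`: a relation name and a tuple of values. -/
abbrev Fact (D : Type*) := ℕ × List D

/-- The fact that an assignment makes of a relational atom. -/
def Atom.fact (v : ℕ → D) (a : Atom) : Fact D :=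
  (a.rel, a.args.map (Term.eval ι v))

/-- The answer `Q(db)`: the head tuples of all assignments that map the relational subgoals into
the database and make the comparisons true. -/
def Query.answer (Q : Query) (db : Set (Fact D)) : Set (List D) :=
  {t | ∃ v : ℕ → D, (∀ a ∈ Q.body, a.fact ι v ∈ db) ∧ (∀ a ∈ Q.acs, a.Holds ι v) ∧
    t = Q.head.map (Term.eval ι v)}

/-- Containment `Q ⊑ Q'`: on every (finite) database, every answer to `Q` is an answer to `Q'`. -/
def Query.Contained (Q Q' : Query) : Prop :=
  ∀ db : Set (Fact D), db.Finite → Q.answer ι db ⊆ Q'.answer ι db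

/-- The variable `n` occurs in a relational subgoal of `Q`. -/
def Query.OccursInBody (Q : Query) (n : ℕ) : Prop :=
  ∃ a ∈ Q.body, Term.var n ∈ a.args

/-- The standing assumptions on a query: it is safe (head variables occur in relational subgoals),
its comparisons are safe (their variables occur in relational subgoals), and its comparisons are
consistent. -/
structure Query.WellFormed (Q : Query) : Prop where
  head_safe : ∀ n, Term.var n ∈ Q.head → Q.OccursInBody n
  lhs_safe : ∀ a ∈ Q.acs, Q.OccursInBody a.lhs
  rhs_safe : ∀ a ∈ Q.acs, ∀ n, a.rhs = .var n → Q.OccursInBody n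
  consistent : ∃ v : ℕ → D, ∀ a ∈ Q.acs, a.Holds ι v

/-- The set of comparisons `β` implies the comparison `a`, i.e. `a` is in the closure of `β`. -/
def Implies (β : List AC) (a : AC) : Prop :=
  ∀ v : ℕ → D, (∀ b ∈ β, b.Holds ι v) → a.Holds ι v

/-- The closure of `β` relates `X` to the constant `c` by the closed LSI `X ≤ c`, this being the
strongest comparison between `X` and `c`: neither `X < c` nor `X = c` is in the closure. -/
def ClosedLSI (β : List AC) (X : ℕ) (c : ℚ) : Prop :=
  Implies ι β ⟨X, .le, .const c⟩ ∧ ¬ Implies ι β ⟨X, .lt, .const c⟩ ∧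
    ¬ Implies ι β ⟨X, .eq, .const c⟩

/-- Likewise for the closed RSI `X ≥ c`. -/
def ClosedRSI (β : List AC) (X : ℕ) (c : ℚ) : Prop :=
  Implies ι β ⟨X, .ge, .const c⟩ ∧ ¬ Implies ι β ⟨X, .gt, .const c⟩ ∧
    ¬ Implies ι β ⟨X, .eq, .const c⟩

/-- The closure of `β` relates `X` to the constant `c` by a closed semi-interval comparison. -/
def ClosedRelated (β : List AC) (X : ℕ) (c : ℚ) : Prop :=
  ClosedLSI ι β X c ∨ ClosedRSI ι β X c

end Semantics

/-- `c` appears in an open LSI `X < c` of `Q`. -/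
def Query.OpenLSIConst (Q : Query) (c : ℚ) : Prop :=
  ∃ X, (⟨X, .lt, .const c⟩ : AC) ∈ Q.acs

/-- `c` appears in an open RSI `X > c` of `Q`. -/
def Query.OpenRSIConst (Q : Query) (c : ℚ) : Prop :=
  ∃ X, (⟨X, .gt, .const c⟩ : AC) ∈ Q.acs

/-- All comparisons of `Q` are of the form `X θ c` with `c` a constant and `θ` one of the two
symbols `l`, `r`, and at most one comparison with the symbol `r` is present. -/
def Query.InClass (l r : CompOp) (Q : Query) : Prop :=
  (∀ a ∈ Q.acs, (a.op = l ∨ a.op = r) ∧ ∃ c : ℚ, a.rhs = .const c) ∧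
  ∀ a ∈ Q.acs, ∀ b ∈ Q.acs, a.op = r → b.op = r → a = b

/-- The normalized form of `Q` introduces no equation: the terms in the head and the relational
subgoals of `Q` are pairwise distinct variables. -/
def Query.EquationFree (Q : Query) : Prop :=
  ∃ xs : List ℕ, xs.Nodup ∧ Q.head ++ Q.body.flatMap Atom.args = xs.map Term.var

/-- The condition on `≠` and shared constants, for the containing query `Q₁` and the contained
query `Q₂`. -/
structure SideCondition {D : Type*} [LinearOrder D] (ι : ℚ ↪o D) (Q₁ Q₂ : Query) : Prop where
  /-- For any `X ≠ Y` in `Q₂`, a constant of an open comparison of `Q₁` is not related to both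
  `X` and `Y` by closed comparisons. -/
  ne_closed : ∀ X Y : ℕ, (⟨X, .ne, .var Y⟩ : AC) ∈ Q₂.acs →
    ∀ c : ℚ, (Q₁.OpenLSIConst c ∨ Q₁.OpenRSIConst c) →
      ¬ (ClosedRelated ι Q₂.acs X c ∧ ClosedRelated ι Q₂.acs Y c)
  /-- If some `X ≠ Y` occurs in `Q₂`, no constant is shared by an open LSI and an open RSI
  of `Q₁`. -/
  ne_shared : ∀ X Y : ℕ, (⟨X, .ne, .var Y⟩ : AC) ∈ Q₂.acs →
    ∀ c : ℚ, Q₁.OpenLSIConst c → ¬ Q₁.OpenRSIConst c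
  /-- If the normalized form of `Q₁` contains equations, then no constant of an open LSI of `Q₁`
  appears in an open RSI of `Q₁` or in a closed LSI of (the closure of) `Q₂`. -/
  normalization : ¬ Q₁.EquationFree →
    ∀ c : ℚ, Q₁.OpenLSIConst c →
      ¬ Q₁.OpenRSIConst c ∧ ∀ X : ℕ, ¬ ClosedLSI ι Q₂.acs X c

/-! ### Encoding of queries as machine data -/

/-- Lists are encoded as right-nested pairs that end in `0`. -/
def encList {α : Type} (f : α → Data) : List α → Data
  | [] => .int 0
  | a :: l => .pair (f a) (encList f l)

/-- Encoding of terms; a rational constant is given by its numerator and denominator. -/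
def Term.enc : Term → Data
  | .var n => .pair (.int 0) (.int n)
  | .const c => .pair (.int 1) (.pair (.int c.num) (.int c.den))

def Atom.enc (a : Atom) : Data :=
  .pair (.int a.rel) (encList Term.enc a.args)

def CompOp.enc : CompOp → Data
  | .lt => .int 0
  | .le => .int 1
  | .gt => .int 2
  | .ge => .int 3
  | .eq => .int 4
  | .ne => .int 5

def AC.enc (a : AC) : Data :=
  .pair a.op.enc (.pair (.int a.lhs) a.rhs.enc)

def Query.enc (Q : Query) : Data :=
  .pair (encList Term.enc Q.head) (.pair (encList Atom.enc Q.body) (encList AC.enc Q.acs))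

/-- The containment problem: given `(Q₁, Q₂)`, where the comparisons of `Q₁` are of the form
`X l c` or `X r c` with at most one of the latter, `Q₂` is any query, and the side condition
holds, decide whether `Q₂ ⊑ Q₁`. -/
def containmentProblem {D : Type*} [LinearOrder D] (ι : ℚ ↪o D) (l r : CompOp) :
    DecisionProblem where
  Inst := {P : Query × Query //
    P.1.WellFormed ι ∧ P.2.WellFormed ι ∧ P.1.InClass l r ∧ SideCondition ι P.1 P.2}
  enc P := .pair P.1.1.enc P.1.2.enc
  yes P := P.1.2.Contained ι P.1.1

end CQAC

/-! Containment fails exactly when some assignment `v` satisfies the comparisons of `Q₂` although no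
assignment of `Q₁` into the frozen body of `Q₂` under `v` gives the same head and satisfies the
comparisons of `Q₁` (`contained_iff`). Such a `v` can be viewed as a solution of constraints whose
atoms are facts `a ≤ b` and `a ≠ b` between terms. The comparisons of `Q₂` are such constraints.
Moreover, whenever a substitution carries the head and the subgoals of `Q₁` to those of `Q₂` up to
known equalities, and the LSIs to known facts, the image of the RSI must fail. Since there is at
most one RSI, its failure is a single comparison and not a disjunction (or a contradiction if there
is no RSI), so consequences can be collected by forward chaining.

The certificate for containment is a derivation of a fact `a ≠ a`, in which each use of the last
rule carries the graph of its substitution as a hint. Only quadratically many facts can be written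
with data from the input, so derivations of polynomial size suffice, and a program can check them in
polynomial time (`PTP.isRefutation`). Soundness (`IsRefutation.contained`) holds because a
counterexample `v` makes every derived fact true.

For completeness, a maximal derivation without contradiction is turned into a counterexample
(`Saturated.not_contained`). By density there is a generic model: it makes terms equal, or puts them
below a constant, only if this was derived (`exists_generic_assignment`). An assignment of `Q₁` into
the frozen body is then read back as a substitution. If the LSIs are closed, their images were
derived, hence so was the negation of the RSI, which contradicts the truth of the RSI.

For an open LSI `X < c`, genericity gives only `X ≤ c`; the fact `X ≠ c` may be underivable. If `Q₁`
is equation-free, the model is changed so that every term `y` with `y ≤ c` derived and `y ≠ c`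
underivable takes the value `c`. The extra equalities do no harm to matching, and the conditions on
`≠` keep the comparisons of `Q₂` true (`Saturated.exists_model`). Otherwise the generic model is
kept: an underivable `≠` would make `X ≤ c` a closed LSI of `Q₂` (`Saturated.closedLSI`), which the
normalization condition excludes. That step needs to trace `X ≤ c` back to `Q₂` alone
(`Saturated.le_cases`). -/

namespace Machine

/-! ### Polynomial-time functions and predicates -/

/-- First component (`0` on leaves). -/
def Data.left (x : Data) : Data := Prim.fst.eval x

/-- Second component (`0` on leaves). -/
def Data.right (x : Data) : Data := Prim.snd.eval x

@[simp] theorem Data.left_pair (a b : Data) : (Data.pair a b).left = a := rfl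
@[simp] theorem Data.right_pair (a b : Data) : (Data.pair a b).right = b := rfl
@[simp] theorem Data.left_int (n : ℤ) : (Data.int n).left = .int 0 := rfl
@[simp] theorem Data.right_int (n : ℤ) : (Data.int n).right = .int 0 := rfl

theorem Data.one_le_size (x : Data) : 1 ≤ x.size := by
  cases x <;> simp only [Data.size] <;> omega

@[simp] theorem Data.size_zero : (Data.int 0).size = 1 := by simp [Data.size]

@[simp] theorem Data.size_one : (Data.int 1).size = 2 := by simp [Data.size]

theorem Data.size_left_le (x : Data) : x.left.size ≤ x.size := by
  cases x
  · simpa using Data.one_le_size _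
  · simp only [Data.left_pair, Data.size]; omega

theorem Data.size_right_le (x : Data) : x.right.size ≤ x.size := by
  cases x <;> simp [Data.size]

/-- The entries of an encoded list. -/
def Data.elems : Data → List Data
  | .int _ => []
  | .pair a b => a :: b.elems

@[simp] theorem Data.elems_int (n : ℤ) : (Data.int n).elems = [] := rfl
@[simp] theorem Data.elems_pair (a b : Data) : (Data.pair a b).elems = a :: b.elems := rfl

theorem Data.length_elems_right (x : Data) : x.right.elems.length = x.elems.length - 1 := by
  cases x <;> simp

theorem Data.length_elems_le (x : Data) : x.elems.length ≤ x.size := by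
  induction x with
  | int n => simp
  | pair a b _ ih => simp [Data.size]; omega

/-- Acceptance asks for some run with output `1`; determinism identifies it with the run that a time
bound provides. -/
theorem Runs.det {p : Prog} {x y : Data} {t : ℕ} (h : Runs p x y t) :
    ∀ {y' : Data} {t' : ℕ}, Runs p x y' t' → y = y' := by
  induction h with
  | prim o x => intro y' t' h; cases h; rfl
  | const d x => intro y' t' h; cases h; rfl
  | pair _ _ ih1 ih2 =>
    intro y' t' h; cases h with
    | pair h1 h2 => rw [ih1 h1, ih2 h2]
  | comp _ _ ih1 ih2 =>
    intro y' t' h; cases h with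
    | comp h1 h2 => obtain rfl := ih1 h1; exact ih2 h2
  | iteTrue _ hb _ ih1 ih2 =>
    intro y' t' h; cases h with
    | iteTrue _ _ h2 => exact ih2 h2
    | iteFalse h1 _ => exact absurd (ih1 h1) hb
  | iteFalse _ _ ih1 ih2 =>
    intro y' t' h; cases h with
    | iteTrue h1 hb _ => exact absurd (ih1 h1).symm hb
    | iteFalse _ h2 => exact ih2 h2
  | loopStop _ ih =>
    intro y' t' h; cases h with
    | loopStop _ => rfl
    | loopStep h1 hb _ _ => exact absurd (ih h1).symm hb
  | loopStep _ hb _ _ ih1 ih2 ih3 =>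
    intro y' t' h; cases h with
    | loopStop h1 => exact absurd (ih1 h1) hb
    | loopStep _ _ h2 h3 => obtain rfl := ih2 h2; exact ih3 h3

/-- Writing the output is charged. Thus a time bound on one program bounds the input of the next one
in a composition. -/
theorem Runs.size_le {p : Prog} {x y : Data} {t : ℕ} (h : Runs p x y t) : y.size ≤ t := by
  induction h <;> first | omega | (simp only [Data.size]; omega)

theorem eval_mono (q : Polynomial ℕ) {m n : ℕ} (h : m ≤ n) : q.eval m ≤ q.eval n := by
  simp only [Polynomial.eval_eq_sum, Polynomial.sum]
  gcongr

/-! ### Closure properties of polynomial-time functions and predicates -/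

/-- The function `f` is computed by a program in polynomial time. -/
def PT (f : Data → Data) : Prop :=
  ∃ (p : Prog) (q : Polynomial ℕ), ∀ x, ∃ t, Runs p x (f x) t ∧ t ≤ q.eval x.size

theorem PT.const (d : Data) : PT fun _ => d :=
  ⟨.const d, Polynomial.C (1 + d.size), fun x => ⟨_, .const d x, by simp⟩⟩

theorem PT.comp {f g : Data → Data} (hg : PT g) (hf : PT f) : PT fun x => g (f x) := by
  obtain ⟨pg, qg, hg⟩ := hg
  obtain ⟨pf, qf, hf⟩ := hf
  refine ⟨.comp pg pf, qf + qg.comp qf + 1, fun x => ?_⟩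
  obtain ⟨s, h1, hs⟩ := hf x
  obtain ⟨t, h2, ht⟩ := hg (f x)
  refine ⟨_, .comp h1 h2, ?_⟩
  have := eval_mono qg (h1.size_le.trans hs)
  simp only [Polynomial.eval_add, Polynomial.eval_comp, Polynomial.eval_one]
  omega

theorem PT.pair {f g : Data → Data} (hf : PT f) (hg : PT g) : PT fun x => .pair (f x) (g x) := by
  obtain ⟨pg, qg, hg⟩ := hg
  obtain ⟨pf, qf, hf⟩ := hf
  refine ⟨.pair pf pg, qf + qg + qf + qg + 1 + Polynomial.X, fun x => ?_⟩
  obtain ⟨s, h1, hs⟩ := hf x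
  obtain ⟨t, h2, ht⟩ := hg x
  refine ⟨_, .pair h1 h2, ?_⟩
  have := h1.size_le
  have := h2.size_le
  simp only [Polynomial.eval_add, Polynomial.eval_X, Polynomial.eval_one]
  omega

theorem PT.ite {c f g : Data → Data} (hc : PT c) (hf : PT f) (hg : PT g) :
    PT fun x => if c x = .int 0 then g x else f x := by
  obtain ⟨pc, qc, hc⟩ := hc
  obtain ⟨pg, qg, hg⟩ := hg
  obtain ⟨pf, qf, hf⟩ := hf
  refine ⟨.ite pc pf pg, qc + qf + qg + 1 + Polynomial.X, fun x => ?_⟩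
  obtain ⟨s, h1, hs⟩ := hc x
  obtain ⟨t, h2, ht⟩ := hf x
  obtain ⟨u, h3, hu⟩ := hg x
  simp only [Polynomial.eval_add, Polynomial.eval_X, Polynomial.eval_one]
  by_cases h : c x = .int 0
  · rw [if_pos h]
    rw [h] at h1
    exact ⟨_, .iteFalse h1 h3, by omega⟩
  · rw [if_neg h]
    exact ⟨_, .iteTrue h1 h h2, by omega⟩

theorem Prim.size_eval_mul_le (m n : ℤ) :
    (Data.int (m * n)).size ≤ 1 + m.natAbs.size + n.natAbs.size := by
  simp only [Data.size, Int.natAbs_mul]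
  have : (m.natAbs * n.natAbs).size ≤ m.natAbs.size + n.natAbs.size := by
    rw [Nat.size_le, pow_add]
    exact Nat.mul_lt_mul'' (Nat.lt_size_self _) (Nat.lt_size_self _)
  omega

theorem PT.prim_of_size {o : Prim} (h : ∀ x, (o.eval x).size ≤ x.size + 1) : PT o.eval := by
  refine ⟨.prim o, 2 * Polynomial.X + 2, fun x => ⟨_, .prim o x, ?_⟩⟩
  have := h x
  simp only [Polynomial.eval_add, Polynomial.eval_mul, Polynomial.eval_X, Polynomial.eval_ofNat]
  omega

theorem PT.id : PT fun x => x :=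
  PT.prim_of_size (o := .id) fun x => by simp [Prim.eval]

theorem PT.left {f : Data → Data} (hf : PT f) : PT fun x => (f x).left :=
  PT.comp (g := Data.left)
    (PT.prim_of_size (o := .fst) fun x => (Data.size_left_le x).trans (Nat.le_succ _)) hf

theorem PT.right {f : Data → Data} (hf : PT f) : PT fun x => (f x).right :=
  PT.comp (g := Data.right)
    (PT.prim_of_size (o := .snd) fun x => (Data.size_right_le x).trans (Nat.le_succ _)) hf

/-- Multiplication of data (`0` unless both are integers). -/
def Data.imul (a b : Data) : Data := Prim.mul.eval (.pair a b)

/-- Comparison of data (false unless both are integers). -/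
def Data.ile (a b : Data) : Prop := Prim.le.eval (.pair a b) = .int 1

/-- The datum is a pair. -/
def Data.IsPair (a : Data) : Prop := Prim.isPair.eval a = .int 1

@[simp] theorem Data.isPair_pair (a b : Data) : (Data.pair a b).IsPair := rfl
@[simp] theorem Data.not_isPair_int (n : ℤ) : ¬ (Data.int n).IsPair := by
  simp [Data.IsPair, Prim.eval]

theorem PT.imul {f g : Data → Data} (hf : PT f) (hg : PT g) :
    PT fun x => (f x).imul (g x) := by
  refine PT.comp (PT.prim_of_size (o := .mul) fun x => ?_) (hf.pair hg)
  rcases x with n | ⟨_ | _, _ | _⟩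
  case pair.int.int m n =>
    have := Prim.size_eval_mul_le m n
    simp only [Prim.eval]
    simp only [Data.size] at *
    omega
  all_goals simp [Prim.eval]

open Classical in
/-- The predicate `P` is decided by a program in polynomial time. -/
def PTP (P : Data → Prop) : Prop := PT fun x => if P x then .int 1 else .int 0

theorem PTP.comp {P : Data → Prop} {f : Data → Data} (hP : PTP P) (hf : PT f) :
    PTP fun x => P (f x) :=
  PT.comp hP hf

theorem PTP.const (C : Prop) : PTP fun _ => C := PT.const _

theorem PTP.not {P : Data → Prop} (hP : PTP P) : PTP fun x => ¬ P x := by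
  have := PT.ite hP (PT.const (.int 0)) (PT.const (.int 1))
  unfold PTP
  convert this using 2 with x
  by_cases h : P x <;> simp [h]

theorem PTP.and {P Q : Data → Prop} (hP : PTP P) (hQ : PTP Q) : PTP fun x => P x ∧ Q x := by
  have := PT.ite hP hQ (PT.const (.int 0))
  unfold PTP
  convert this using 2 with x
  by_cases h : P x <;> by_cases h' : Q x <;> simp [h, h']

theorem PTP.or {P Q : Data → Prop} (hP : PTP P) (hQ : PTP Q) : PTP fun x => P x ∨ Q x := by
  have := (hP.not.and hQ.not).not
  convert this using 2 with x
  tauto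

theorem PTP.imp {P Q : Data → Prop} (hP : PTP P) (hQ : PTP Q) : PTP fun x => P x → Q x := by
  have := (hP.and hQ.not).not
  convert this using 2 with x
  tauto

theorem PTP.eq {f g : Data → Data} (hf : PT f) (hg : PT g) : PTP fun x => f x = g x := by
  have h : PT Prim.eq.eval := PT.prim_of_size fun x => by
    rcases x with n | ⟨a, b⟩
    · simp [Prim.eval]
    · have := a.one_le_size
      by_cases h : a = b
      · simp only [Prim.eval, h, if_true, Data.size_one, Data.size]; omega
      · simp only [Prim.eval, h, if_false, Data.size_zero, Data.size]; omega
  have h' := PT.comp h (hf.pair hg)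
  unfold PTP
  convert h' using 2 with x
  by_cases e : f x = g x <;> simp [e, Prim.eval]

theorem PTP.isPair {f : Data → Data} (hf : PT f) : PTP fun x => (f x).IsPair :=
  PTP.eq (PT.comp (PT.prim_of_size (o := .isPair) fun x => by
    have := x.one_le_size
    cases x <;> simp [Prim.eval] ; omega) hf) (PT.const _)

theorem PTP.ile {f g : Data → Data} (hf : PT f) (hg : PT g) : PTP fun x => (f x).ile (g x) := by
  refine PTP.eq (PT.comp (PT.prim_of_size (o := .le) fun x => ?_) (hf.pair hg)) (PT.const _)
  rcases x with n | ⟨_ | _, _ | _⟩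
  case pair.int.int m n => by_cases h : m ≤ n <;> simp [Prim.eval, h, Data.size] ; omega
  all_goals simp [Prim.eval]

/-- A loop whose number of rounds and whose data are under control runs in polynomial time. -/
theorem PT.iterate {c F : Data → Data} (hc : PT c) (hF : PT F) (n : Data → ℕ)
    (h0 : ∀ x, n x = 0 → c x = .int 0) (h1 : ∀ x, n x ≠ 0 → c x ≠ .int 0)
    (hn : ∀ x, n (F x) = n x - 1) (hsz : ∀ x, (F x).size ≤ x.size + 8)
    (hns : ∀ x, n x ≤ x.size) : PT fun x => F^[n x] x := by
  obtain ⟨pc, qc, hc⟩ := hc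
  obtain ⟨pf, qf, hF⟩ := hF
  -- `M` bounds all states of the loop at once, as each remaining round adds at most 8. With at most
  -- `x.size` rounds, `M = 9 * x.size` works.
  have key : ∀ (M k : ℕ) (x : Data), n x = k → x.size + 8 * k ≤ M →
      ∃ t, Runs (.loop pc pf) x (F^[k] x) t ∧
        t ≤ (k + 1) * (qc.eval M + qf.eval M + 1 + M) := by
    intro M k
    induction k with
    | zero =>
      intro x hx hM
      obtain ⟨s, h, hs⟩ := hc x
      rw [h0 x hx] at h
      refine ⟨_, .loopStop h, ?_⟩
      have := eval_mono qc (show x.size ≤ M by omega)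
      omega
    | succ k ih =>
      intro x hx hM
      obtain ⟨s, h, hs⟩ := hc x
      obtain ⟨u, h', hu⟩ := hF x
      have := hsz x
      obtain ⟨w, h'', hw⟩ := ih (F x) (by rw [hn, hx]; omega) (by omega)
      refine ⟨_, .loopStep h (h1 x (by omega)) h' h'', ?_⟩
      have := eval_mono qc (show x.size ≤ M by omega)
      have := eval_mono qf (show x.size ≤ M by omega)
      rw [add_mul _ 1 (_ : ℕ)]
      omega
  refine ⟨.loop pc pf, (Polynomial.X + 1) * (qc.comp (9 * Polynomial.X) +
    qf.comp (9 * Polynomial.X) + 1 + 9 * Polynomial.X), fun x => ?_⟩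
  have hx := hns x
  obtain ⟨t, h, ht⟩ := key (9 * x.size) (n x) x rfl (by omega)
  refine ⟨t, h, ht.trans ?_⟩
  simp only [Polynomial.eval_add, Polynomial.eval_mul, Polynomial.eval_comp, Polynomial.eval_X,
    Polynomial.eval_ofNat, Polynomial.eval_one]
  gcongr

/-- Simultaneous scan of two encoded lists: `R` holds for each entry of the first list and the
corresponding rest of the second list, and `B` for what is left of the second list. -/
def scan (R : Data → Data → Prop) (B : Data → Prop) : Data → Data → Prop
  | .int _, m => B m
  | .pair e t, m => R e m ∧ scan R B t m.right

/-- Recursion scheme behind `scan`: the state holds the parameter, the truth value so far, and the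
rests of the two lists. -/
theorem iterate_scan_iff {F : Data → Data} {R : Data → Data → Data → Prop} {B : Data → Prop}
    (hF : ∀ z b e t m, ∃ b', F (.pair z (.pair b (.pair (.pair e t) m))) =
      .pair z (.pair b' (.pair t m.right)) ∧ (b' = .int 1 ↔ b = .int 1 ∧ R z e m))
    (l : Data) : ∀ z b m,
    (F^[l.elems.length] (.pair z (.pair b (.pair l m)))).right.left = .int 1 ∧
      B (F^[l.elems.length] (.pair z (.pair b (.pair l m)))).right.right.right ↔
      b = .int 1 ∧ scan (R z) B l m := by
  induction l with
  | int n => intro z b m; simp [scan]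
  | pair e t _ ih =>
    intro z b m
    obtain ⟨b', h, hb⟩ := hF z b e t m
    simp only [Data.elems_pair, List.length_cons, Function.iterate_succ_apply, h, ih, hb, scan]
    tauto

/-- One loop does the scan: it pops both lists in each round and keeps the conjunction of the tests
in a bit; `B` is tested at the end. -/
theorem PTP.scan {R : Data → Data → Data → Prop} {B : Data → Prop} {f g : Data → Data}
    (hR : PTP fun w => R w.left w.right.left w.right.right) (hB : PTP B) (hf : PT f) (hg : PT g) :
    PTP fun z => scan (R z) B (f z) (g z) := by
  classical
  let bit : Data → Data := fun s => if s.right.left = .int 1 ∧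
    R s.left s.right.right.left.left s.right.right.right then .int 1 else .int 0
  let F : Data → Data := fun s => .pair s.left (.pair (bit s)
    (.pair s.right.right.left.right s.right.right.right.right))
  have hbit : PT bit := by
    have := PTP.and (PTP.eq PT.id.right.left (PT.const (.int 1)))
      (hR.comp (PT.id.left.pair (PT.id.right.right.left.left.pair PT.id.right.right.right)))
    simp only [PTP, Data.left_pair, Data.right_pair] at this
    convert this using 2
    simp only [bit]
    congr
  have hFPT : PT F := PT.id.left.pair
    (hbit.pair (PT.id.right.right.left.right.pair PT.id.right.right.right.right))
  have hiter := PT.iterate (c := fun s => if s.right.right.left.IsPair then .int 1 else .int 0)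
    (PTP.isPair PT.id.right.right.left) hFPT (fun s => s.right.right.left.elems.length)
    (fun s h => by
      rcases h' : s.right.right.left with n | ⟨a, b⟩
      · simp
      · simp [h'] at h)
    (fun s h => by
      rcases h' : s.right.right.left with n | ⟨a, b⟩
      · simp [h'] at h
      · simp)
    (fun s => by simp [F, Data.length_elems_right])
    -- On well-formed states only the bit can grow. The allowance 8 covers malformed states, which
    -- `F` rebuilds with the full nesting of pairs.
    (fun s => by
      have hb : (bit s).size ≤ 2 := by
        simp only [bit]; split_ifs <;> simp
      rcases s with n | ⟨z, n | ⟨b, n | ⟨l, m⟩⟩⟩ <;> simp only [F, Data.size, Data.left_pair,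
        Data.right_pair, Data.left_int, Data.right_int, Data.size_zero]
      · omega
      · omega
      · omega
      · have := Data.size_right_le l
        have := Data.size_right_le m
        have := b.one_le_size
        omega)
    (fun s => (Data.length_elems_le _).trans ((Data.size_left_le _).trans
      ((Data.size_right_le _).trans (Data.size_right_le _))))
  have hstart : PT fun z => Data.pair z (.pair (.int 1) (.pair (f z) (g z))) :=
    PT.id.pair ((PT.const _).pair (hf.pair hg))
  have hend := PT.comp hiter hstart
  have := (PTP.eq hend.right.left (PT.const (.int 1))).and (hB.comp hend.right.right.right)
  convert this using 2 with z
  refine Iff.symm ((iterate_scan_iff (F := F) (R := R)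
    (fun z b e t m => ⟨_, rfl, ?_⟩) (f z) z (.int 1) (g z)).trans ?_)
  · by_cases h : b = .int 1 ∧ R z e m
    · simp [bit, h]
    · simp only [bit, Data.left_pair, Data.right_pair, h]; simp
  · simp

theorem scan_const_iff {P : Data → Prop} (l m : Data) :
    scan (fun e _ => P e) (fun _ => True) l m ↔ ∀ e ∈ l.elems, P e := by
  induction l generalizing m with
  | int n => simp [scan]
  | pair e t _ ih => simp [scan, ih]

/-- A bounded quantifier is a scan that ignores its second list. -/
theorem PTP.ball {P : Data → Data → Prop} {g : Data → Data} (hg : PT g)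
    (hP : PTP fun w => P w.left w.right) : PTP fun z => ∀ e ∈ (g z).elems, P z e := by
  have h := PTP.scan (R := fun z e _ => P z e) (hP.comp (PT.id.left.pair PT.id.right.left))
    (PTP.const True) hg hg
  simpa only [scan_const_iff] using h

theorem PTP.bex {P : Data → Data → Prop} {g : Data → Data} (hg : PT g)
    (hP : PTP fun w => P w.left w.right) : PTP fun z => ∃ e ∈ (g z).elems, P z e := by
  have h := (PTP.ball (P := fun z e => ¬ P z e) hg hP.not).not
  simpa only [not_forall, not_not, exists_prop] using h

/-- A language with polynomial-time decidable certificates of polynomial size is in NP. -/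
theorem exists_NP {P : Data → Data → Prop} (hP : PTP fun w => P w.left w.right)
    (p : Polynomial ℕ) :
    ∃ L : Set Data, NP L ∧ ∀ x, x ∈ L ↔ ∃ y : Data, y.size ≤ p.eval x.size ∧ P x y := by
  classical
  obtain ⟨V, q, hV⟩ := hP
  refine ⟨{x | ∃ y : Data, y.size ≤ p.eval x.size ∧ ∃ t, Runs V (.pair x y) (.int 1) t},
    ⟨V, p, q.comp (1 + Polynomial.X + p), fun x y hy => ?_, fun x => Iff.rfl⟩, fun x => ?_⟩
  · obtain ⟨t, h, ht⟩ := hV (.pair x y)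
    refine ⟨_, t, h, ht.trans ?_⟩
    simp only [Polynomial.eval_comp, Polynomial.eval_add, Polynomial.eval_one, Polynomial.eval_X]
    exact eval_mono q (by simp only [Data.size]; omega)
  · refine exists_congr fun y => and_congr_right fun _ => ?_
    obtain ⟨t, h, -⟩ := hV (.pair x y)
    constructor
    · rintro ⟨t', h'⟩
      by_contra hn
      have := h.det h'
      simp [hn] at this
    · intro hy
      simp only [Data.left_pair, Data.right_pair, hy, if_true] at h
      exact ⟨t, h⟩

end Machine

namespace CQAC

open Machine Machine.Data

/-! ### Derivations of comparisons -/

/-- The fact `a ≤ b`. -/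
def leFact (a b : Data) : Data := .pair (.int 0) (.pair a b)

/-- The fact `a ≠ b`. -/
def neFact (a b : Data) : Data := .pair (.int 1) (.pair a b)

/-- The code of the variable with code number `n`. -/
def varData (n : Data) : Data := .pair (.int 0) n

/-- The fact `f` is listed in the derivation `L`, whose entries are pairs of a fact and a hint. -/
def Known (L f : Data) : Prop := ∃ e ∈ L.elems, e.left = f

/-- The equality of `a` and `b` is listed in `L`. -/
def KnownEq (L a b : Data) : Prop := Known L (leFact a b) ∧ Known L (leFact b a)

/-- `f` is a direct consequence of the encoded comparison `c`. -/
def ByComparison (c f : Data) : Prop :=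
  (f = leFact (varData c.right.left) c.right.right ∧
    (c.left = CompOp.enc .lt ∨ c.left = CompOp.enc .le ∨ c.left = CompOp.enc .eq)) ∨
  (f = leFact c.right.right (varData c.right.left) ∧
    (c.left = CompOp.enc .gt ∨ c.left = CompOp.enc .ge ∨ c.left = CompOp.enc .eq)) ∨
  (f = neFact (varData c.right.left) c.right.right ∧
    (c.left = CompOp.enc .lt ∨ c.left = CompOp.enc .gt ∨ c.left = CompOp.enc .ne))

/-- `f` is a true comparison of two rational constants. -/
def ByConstants (f : Data) : Prop :=
  (f.right.left.left = .int 1 ∧ f.right.right.left = .int 1) ∧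
  ((Data.int 1).ile f.right.left.right.right ∧ (Data.int 1).ile f.right.right.right.right) ∧
  ((f = leFact f.right.left f.right.right ∧
    (f.right.left.right.left.imul f.right.right.right.right).ile
      (f.right.right.right.left.imul f.right.left.right.right)) ∨
  (f = neFact f.right.left f.right.right ∧
    f.right.left.right.left.imul f.right.right.right.right ≠
      f.right.right.right.left.imul f.right.left.right.right))

/-- `f` follows from listed facts by the laws of a linear order. -/
def ByOrder (L f : Data) : Prop :=
  f = leFact f.right.left f.right.left ∨
  (f = leFact f.right.left f.right.right ∧ ∃ g ∈ L.elems,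
    Known L (leFact f.right.left g.left.right.right) ∧
    Known L (leFact g.left.right.right f.right.right)) ∨
  (f = neFact f.right.left f.right.right ∧ ∃ g ∈ L.elems,
    Known L (neFact g.left.right.left g.left.right.right) ∧
    (Known L (leFact f.right.left g.left.right.left) ∧
      Known L (leFact g.left.right.left f.right.right)) ∧
    (Known L (leFact f.right.left g.left.right.right) ∧
      Known L (leFact g.left.right.right f.right.right)))

/-- The image of the term `s` under the graph `H` of a substitution equals `t` according to `L`. -/
def MatchTerm (H L s t : Data) : Prop :=
  (s.left = .int 0 ∧ ∃ p ∈ H.elems, p.left = s ∧ KnownEq L p.right t) ∨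
  (s.left ≠ .int 0 ∧ KnownEq L s t)

/-- Entrywise `MatchTerm`. -/
def MatchArgs (H L a b : Data) : Prop :=
  scan (fun s m => m.IsPair ∧ MatchTerm H L s m.left) (fun m => ¬ m.IsPair) a b

/-- The substitution with graph `H` maps the head and the relational subgoals of the first query of
`x` to those of the second one, and the comparisons with symbol `l` to consequences of `L`. -/
def IsMapping (l : CompOp) (x H L : Data) : Prop :=
  (∀ p ∈ H.elems, ∀ q ∈ H.elems, p.left = q.left → p.right = q.right) ∧
  MatchArgs H L x.left.left x.right.left ∧
  (∀ a ∈ x.left.right.left.elems, ∃ b ∈ x.right.right.left.elems,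
    a.left = b.left ∧ MatchArgs H L a.right b.right) ∧
  ∀ c ∈ x.left.right.right.elems, c.left = l.enc →
    ∃ p ∈ H.elems, p.left = varData c.right.left ∧ Known L (leFact p.right c.right.right) ∧
      (l = .lt → Known L (neFact p.right c.right.right))

/-- `f` is part of the negation of the image, under the substitution with graph `H`, of the
comparison with symbol `r` of the first query of `x`. -/
def NegatesRSI (r : CompOp) (x H f : Data) : Prop :=
  (∃ c ∈ x.left.right.right.elems, c.left = r.enc ∧
    ∃ p ∈ H.elems, p.left = varData c.right.left ∧
      (f = leFact p.right c.right.right ∨ (r = .ge ∧ f = neFact p.right c.right.right))) ∨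
  ((∀ c ∈ x.left.right.right.elems, c.left ≠ r.enc) ∧ f = neFact f.right.left f.right.left)

/-- The fact `f` with the hint `H` may be added to the derivation `L`. -/
def Justified (l r : CompOp) (x f H L : Data) : Prop :=
  (∃ c ∈ x.right.right.right.elems, ByComparison c f) ∨ ByConstants f ∨ ByOrder L f ∨
    (IsMapping l x H L ∧ NegatesRSI r x H f)

/-- `C` is a derivation. -/
def IsDerivation (l r : CompOp) (x C : Data) : Prop :=
  scan (fun e m => Justified l r x e.left e.right m.right) (fun _ => True) C C

/-- `C` is a derivation of a contradiction. -/
def IsRefutation (l r : CompOp) (x C : Data) : Prop :=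
  IsDerivation l r x C ∧ ∃ e ∈ C.elems, e.left = neFact e.left.right.left e.left.right.left

/-! ### Refutations are checkable in polynomial time -/

section Complexity

theorem PT.leFact {f g : Data → Data} (hf : PT f) (hg : PT g) : PT fun z => leFact (f z) (g z) :=
  (PT.const _).pair (hf.pair hg)

theorem PT.neFact {f g : Data → Data} (hf : PT f) (hg : PT g) : PT fun z => neFact (f z) (g z) :=
  (PT.const _).pair (hf.pair hg)

theorem PT.varData {f : Data → Data} (hf : PT f) : PT fun z => varData (f z) :=
  (PT.const _).pair hf

theorem PTP.known {L f : Data → Data} (hL : PT L) (hf : PT f) : PTP fun z => Known (L z) (f z) :=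
  PTP.bex (P := fun z e => e.left = f z) hL (PTP.eq PT.id.right.left (hf.comp PT.id.left))

theorem PTP.knownEq {L f g : Data → Data} (hL : PT L) (hf : PT f) (hg : PT g) :
    PTP fun z => KnownEq (L z) (f z) (g z) :=
  (PTP.known hL (PT.leFact hf hg)).and (PTP.known hL (PT.leFact hg hf))

theorem PTP.byComparison {c f : Data → Data} (hc : PT c) (hf : PT f) :
    PTP fun z => ByComparison (c z) (f z) := by
  have hop (o : Data) : PTP fun z => (c z).left = o := PTP.eq hc.left (PT.const o)
  exact ((PTP.eq hf (PT.leFact (PT.varData hc.right.left) hc.right.right)).and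
      ((hop _).or ((hop _).or (hop _)))).or
    (((PTP.eq hf (PT.leFact hc.right.right (PT.varData hc.right.left))).and
      ((hop _).or ((hop _).or (hop _)))).or
    ((PTP.eq hf (PT.neFact (PT.varData hc.right.left) hc.right.right)).and
      ((hop _).or ((hop _).or (hop _)))))

theorem PTP.byConstants {f : Data → Data} (hf : PT f) : PTP fun z => ByConstants (f z) := by
  have ha := hf.right.left
  have hb := hf.right.right
  have h1 := ha.right.left.imul hb.right.right
  have h2 := hb.right.left.imul ha.right.right
  exact ((PTP.eq ha.left (PT.const _)).and (PTP.eq hb.left (PT.const _))).and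
    (((PTP.ile (PT.const _) ha.right.right).and (PTP.ile (PT.const _) hb.right.right)).and
    (((PTP.eq hf (PT.leFact ha hb)).and (PTP.ile h1 h2)).or
    ((PTP.eq hf (PT.neFact ha hb)).and (PTP.eq h1 h2).not)))

theorem PTP.byOrder {L f : Data → Data} (hL : PT L) (hf : PT f) :
    PTP fun z => ByOrder (L z) (f z) := by
  have ha := hf.right.left
  have hb := hf.right.right
  have hL' := hL.comp PT.id.left
  have ha' := ha.comp PT.id.left
  have hb' := hb.comp PT.id.left
  have hu := PT.id.right.left.right.left
  have hw := PT.id.right.left.right.right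
  exact (PTP.eq hf (PT.leFact ha ha)).or
    (((PTP.eq hf (PT.leFact ha hb)).and (PTP.bex
      (P := fun z g => Known (L z) (CQAC.leFact (f z).right.left g.left.right.right) ∧
        Known (L z) (CQAC.leFact g.left.right.right (f z).right.right)) hL
      ((PTP.known hL' (PT.leFact ha' hw)).and (PTP.known hL' (PT.leFact hw hb'))))).or
    ((PTP.eq hf (PT.neFact ha hb)).and (PTP.bex
      (P := fun z g => Known (L z) (CQAC.neFact g.left.right.left g.left.right.right) ∧
        (Known (L z) (CQAC.leFact (f z).right.left g.left.right.left) ∧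
          Known (L z) (CQAC.leFact g.left.right.left (f z).right.right)) ∧
        (Known (L z) (CQAC.leFact (f z).right.left g.left.right.right) ∧
          Known (L z) (CQAC.leFact g.left.right.right (f z).right.right))) hL
      ((PTP.known hL' (PT.neFact hu hw)).and
        (((PTP.known hL' (PT.leFact ha' hu)).and (PTP.known hL' (PT.leFact hu hb'))).and
        ((PTP.known hL' (PT.leFact ha' hw)).and (PTP.known hL' (PT.leFact hw hb'))))))))

theorem PTP.matchTerm {H L s t : Data → Data} (hH : PT H) (hL : PT L) (hs : PT s) (ht : PT t) :
    PTP fun z => MatchTerm (H z) (L z) (s z) (t z) :=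
  ((PTP.eq hs.left (PT.const _)).and (PTP.bex
    (P := fun z p => p.left = s z ∧ KnownEq (L z) p.right (t z)) hH
    ((PTP.eq PT.id.right.left (hs.comp PT.id.left)).and
      (PTP.knownEq (hL.comp PT.id.left) PT.id.right.right (ht.comp PT.id.left))))).or
  ((PTP.eq hs.left (PT.const _)).not.and (PTP.knownEq hL hs ht))

theorem PTP.matchArgs {H L s t : Data → Data} (hH : PT H) (hL : PT L) (hs : PT s) (ht : PT t) :
    PTP fun z => MatchArgs (H z) (L z) (s z) (t z) :=
  PTP.scan (R := fun z s m => m.IsPair ∧ MatchTerm (H z) (L z) s m.left)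
    ((PTP.isPair PT.id.right.right).and (PTP.matchTerm (hH.comp PT.id.left) (hL.comp PT.id.left)
      PT.id.right.left PT.id.right.right.left)) (PTP.isPair PT.id).not hs ht

theorem PTP.isMapping (l : CompOp) {x H L : Data → Data} (hx : PT x) (hH : PT H) (hL : PT L) :
    PTP fun z => IsMapping l (x z) (H z) (L z) := by
  refine PTP.and ?_ (PTP.and ?_ (PTP.and ?_ ?_))
  · refine PTP.ball (P := fun z p => ∀ q ∈ (H z).elems, p.left = q.left → p.right = q.right) hH
      (PTP.ball (P := fun w q => w.right.left = q.left → w.right.right = q.right)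
        (hH.comp PT.id.left) ?_)
    exact (PTP.eq PT.id.left.right.left PT.id.right.left).imp
      (PTP.eq PT.id.left.right.right PT.id.right.right)
  · exact PTP.matchArgs hH hL hx.left.left hx.right.left
  · refine PTP.ball (P := fun z a => ∃ b ∈ (x z).right.right.left.elems,
      a.left = b.left ∧ MatchArgs (H z) (L z) a.right b.right) hx.left.right.left
      (PTP.bex (P := fun w b => w.right.left = b.left ∧
        MatchArgs (H w.left) (L w.left) w.right.right b.right)
        (hx.comp PT.id.left).right.right.left ?_)
    exact (PTP.eq PT.id.left.right.left PT.id.right.left).and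
      (PTP.matchArgs (hH.comp PT.id.left.left) (hL.comp PT.id.left.left)
        PT.id.left.right.right PT.id.right.right)
  · refine PTP.ball (P := fun z c => c.left = l.enc → ∃ p ∈ (H z).elems,
      p.left = CQAC.varData c.right.left ∧ Known (L z) (CQAC.leFact p.right c.right.right) ∧
      (l = .lt → Known (L z) (CQAC.neFact p.right c.right.right))) hx.left.right.right
      ((PTP.eq PT.id.right.left (PT.const _)).imp
      (PTP.bex (P := fun w p => p.left = CQAC.varData w.right.right.left ∧
        Known (L w.left) (CQAC.leFact p.right w.right.right.right) ∧
        (l = .lt → Known (L w.left) (CQAC.neFact p.right w.right.right.right)))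
        (hH.comp PT.id.left) ?_))
    have hL' := hL.comp PT.id.left.left
    have hp := PT.id.right.right
    have hc := PT.id.left.right.right.right
    exact (PTP.eq PT.id.right.left (PT.varData PT.id.left.right.right.left)).and
      ((PTP.known hL' (PT.leFact hp hc)).and
      ((PTP.const _).imp (PTP.known hL' (PT.neFact hp hc))))

theorem PTP.negatesRSI (r : CompOp) {x H f : Data → Data} (hx : PT x) (hH : PT H) (hf : PT f) :
    PTP fun z => NegatesRSI r (x z) (H z) (f z) := by
  refine PTP.or ?_ (PTP.and ?_ ?_)
  · refine PTP.bex (P := fun z c => c.left = r.enc ∧ ∃ p ∈ (H z).elems,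
      p.left = CQAC.varData c.right.left ∧ (f z = CQAC.leFact p.right c.right.right ∨
        (r = .ge ∧ f z = CQAC.neFact p.right c.right.right))) hx.left.right.right
      ((PTP.eq PT.id.right.left (PT.const _)).and
      (PTP.bex (P := fun w p => p.left = CQAC.varData w.right.right.left ∧
        (f w.left = CQAC.leFact p.right w.right.right.right ∨
          (r = .ge ∧ f w.left = CQAC.neFact p.right w.right.right.right)))
        (hH.comp PT.id.left) ?_))
    have hf' := hf.comp PT.id.left.left
    have hp := PT.id.right.right
    have hc := PT.id.left.right.right.right
    exact (PTP.eq PT.id.right.left (PT.varData PT.id.left.right.right.left)).and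
      ((PTP.eq hf' (PT.leFact hp hc)).or
      ((PTP.const _).and (PTP.eq hf' (PT.neFact hp hc))))
  · exact PTP.ball (P := fun z c => c.left ≠ r.enc) hx.left.right.right
      (PTP.eq PT.id.right.left (PT.const _)).not
  · exact PTP.eq hf (PT.neFact hf.right.left hf.right.left)

theorem PTP.isRefutation (l r : CompOp) : PTP fun w => IsRefutation l r w.left w.right := by
  refine PTP.and (PTP.scan (f := Data.right) (g := Data.right)
    (R := fun w e m => Justified l r w.left e.left e.right m.right) ?_ (PTP.const True)
    PT.id.right PT.id.right) (PTP.bex (g := Data.right)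
    (P := fun _ e => e.left = CQAC.neFact e.left.right.left e.left.right.left) PT.id.right
    (PTP.eq PT.id.right.left
      (PT.neFact PT.id.right.left.right.left PT.id.right.left.right.left)))
  have hx := PT.id.left.left
  have hf := PT.id.right.left.left
  have hH := PT.id.right.left.right
  have hL := PT.id.right.right.right
  refine PTP.or (PTP.bex (P := fun w c => ByComparison c w.right.left.left) hx.right.right.right
    (PTP.byComparison PT.id.right (hf.comp PT.id.left)))
    ((PTP.byConstants hf).or ((PTP.byOrder hL hf).or ((PTP.isMapping l hx hH hL).and
      (PTP.negatesRSI r hx hH hf))))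

end Complexity

end CQAC

namespace CQAC

open Machine Machine.Data

/-! ### Soundness of derivations -/

/-- The integer at a leaf. -/
def toInt : Data → ℤ
  | .int n => n
  | .pair _ _ => 0

@[simp] theorem toInt_int (n : ℤ) : toInt (.int n) = n := rfl

theorem imul_eq (a b : Data) : a.imul b = .int (toInt a * toInt b) := by
  cases a <;> cases b <;> simp [Data.imul, Prim.eval, toInt]

theorem ile_int (m n : ℤ) : (Data.int m).ile (.int n) ↔ m ≤ n := by
  by_cases h : m ≤ n <;> simp [Data.ile, Prim.eval, h]

theorem toInt_le_of_ile {a b : Data} (h : a.ile b) : toInt a ≤ toInt b := by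
  cases a <;> cases b <;> first | exact (ile_int _ _).1 h | simp [Data.ile, Prim.eval] at h

theorem Term.enc_injective : Function.Injective Term.enc := by
  intro s t h
  rcases s with m | c <;> rcases t with n | d <;> simp [Term.enc] at h
  · rw [h]
  · rw [Rat.ext h.1 h.2]

theorem CompOp.enc_injective : Function.Injective CompOp.enc := by
  intro a b h
  cases a <;> cases b <;> first | rfl | (simp [CompOp.enc] at h)

@[simp] theorem Term.left_enc_var (n : ℕ) : (Term.var n).enc.left = .int 0 := rfl
@[simp] theorem Term.left_enc_const (c : ℚ) : (Term.const c).enc.left = .int 1 := rfl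

theorem varData_int (n : ℕ) : varData (.int n) = (Term.var n).enc := rfl

@[simp] theorem elems_encList {α : Type} (f : α → Data) (l : List α) :
    (encList f l).elems = l.map f := by
  induction l with
  | nil => rfl
  | cons a l ih => simp [encList, ih]

@[simp] theorem leFact_inj {a b c d : Data} : leFact a b = leFact c d ↔ a = c ∧ b = d := by
  simp [leFact]

@[simp] theorem neFact_inj {a b c d : Data} : neFact a b = neFact c d ↔ a = c ∧ b = d := by
  simp [neFact]

@[simp] theorem leFact_ne_neFact {a b c d : Data} : leFact a b ≠ neFact c d := by
  simp [leFact, neFact]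

theorem matchArgs_encList {H L : Data} (s t : List Term) :
    MatchArgs H L (encList Term.enc s) (encList Term.enc t) ↔
      List.Forall₂ (fun a b => MatchTerm H L a.enc b.enc) s t := by
  unfold MatchArgs
  induction s generalizing t with
  | nil => cases t <;> simp [encList, scan]
  | cons a s ih => cases t <;> simp [encList, scan, ih]

section

variable {D : Type*} [LinearOrder D] (ι : ℚ ↪o D)

/-- The value of a coded term; the coding of rational constants need not be reduced. -/
def codeVal (v : ℕ → D) (d : Data) : D :=
  if d.left = .int 0 then v (toInt d.right).toNat
  else ι ((toInt d.right.left : ℚ) / toInt d.right.right)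

@[simp] theorem codeVal_enc (v : ℕ → D) (t : Term) : codeVal ι v t.enc = t.eval ι v := by
  cases t
  · simp [codeVal, Term.enc, Term.eval]
  · simp [codeVal, Term.enc, Term.eval, Rat.num_div_den]

/-- Truth of a coded fact. -/
def FactHolds (v : ℕ → D) (f : Data) : Prop :=
  if f.left = .int 0 then codeVal ι v f.right.left ≤ codeVal ι v f.right.right
  else codeVal ι v f.right.left ≠ codeVal ι v f.right.right

@[simp] theorem factHolds_leFact (v : ℕ → D) (a b : Data) :
    FactHolds ι v (leFact a b) ↔ codeVal ι v a ≤ codeVal ι v b := by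
  simp [FactHolds, leFact]

@[simp] theorem factHolds_neFact (v : ℕ → D) (a b : Data) :
    FactHolds ι v (neFact a b) ↔ codeVal ι v a ≠ codeVal ι v b := by
  simp [FactHolds, neFact]

variable {ι}

theorem ByComparison.holds {v : ℕ → D} {c : AC} {f : Data} (h : ByComparison c.enc f)
    (hc : c.Holds ι v) : FactHolds ι v f := by
  obtain ⟨n, op, t⟩ := c
  simp only [ByComparison, AC.enc, left_pair, right_pair, varData_int,
    CompOp.enc_injective.eq_iff] at h
  rcases h with ⟨rfl, h⟩ | ⟨rfl, h⟩ | ⟨rfl, h⟩ <;> rcases h with rfl | rfl | rfl <;>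
    simp only [AC.Holds, CompOp.Rel] at hc <;> simp only [factHolds_leFact, factHolds_neFact,
      codeVal_enc, Term.eval] <;>
    first
    | exact hc.le | exact hc | exact hc.ge | exact hc.ne | exact hc.ne'

theorem ByConstants.holds {f : Data} (h : ByConstants f) (v : ℕ → D) : FactHolds ι v f := by
  obtain ⟨⟨ha, hb⟩, ⟨hm, hn⟩, h⟩ := h
  have hm := toInt_le_of_ile hm
  have hn := toInt_le_of_ile hn
  have hm' : (0 : ℚ) < toInt f.right.left.right.right := by
    exact_mod_cast Int.lt_of_lt_of_le one_pos hm
  have hn' : (0 : ℚ) < toInt f.right.right.right.right := by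
    exact_mod_cast Int.lt_of_lt_of_le one_pos hn
  simp only [imul_eq] at h
  rcases h with ⟨hf, h⟩ | ⟨hf, h⟩
  · rw [hf, factHolds_leFact]
    simp only [codeVal, ha, hb, Data.int.injEq, one_ne_zero, if_false]
    rw [OrderEmbedding.le_iff_le, div_le_div_iff₀ hm' hn']
    exact_mod_cast (ile_int _ _).1 h
  · rw [hf, factHolds_neFact]
    simp only [codeVal, ha, hb, Data.int.injEq, one_ne_zero, if_false]
    rw [Ne, ι.injective.eq_iff, div_eq_div_iff hm'.ne' hn'.ne']
    intro h'
    exact h (congrArg _ (by exact_mod_cast h'))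

theorem Known.holds {v : ℕ → D} {L f : Data} (h : Known L f)
    (hL : ∀ e ∈ L.elems, FactHolds ι v e.left) : FactHolds ι v f := by
  obtain ⟨e, he, rfl⟩ := h
  exact hL e he

theorem KnownEq.codeVal_eq {v : ℕ → D} {L a b : Data} (h : KnownEq L a b)
    (hL : ∀ e ∈ L.elems, FactHolds ι v e.left) : codeVal ι v a = codeVal ι v b :=
  le_antisymm ((factHolds_leFact ..).1 (h.1.holds hL)) ((factHolds_leFact ..).1 (h.2.holds hL))

theorem ByOrder.holds {v : ℕ → D} {L f : Data} (h : ByOrder L f)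
    (hL : ∀ e ∈ L.elems, FactHolds ι v e.left) : FactHolds ι v f := by
  rcases h with hf | ⟨hf, g, -, h1, h2⟩ | ⟨hf, g, -, h1, ⟨h2, h3⟩, h4, h5⟩ <;> rw [hf]
  · simp
  · have h1 := h1.holds hL
    have h2 := h2.holds hL
    simp only [factHolds_leFact] at *
    exact h1.trans h2
  · have h1 := h1.holds hL
    have h2 := h2.holds hL
    have h3 := h3.holds hL
    have h4 := h4.holds hL
    have h5 := h5.holds hL
    simp only [factHolds_leFact, factHolds_neFact] at *
    intro e
    rw [← e] at h3 h5
    exact h1 ((le_antisymm h2 h3).symm.trans (le_antisymm h4 h5))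

/-- The facts that an assignment makes of the relational subgoals. -/
def Query.canonical (ι : ℚ ↪o D) (Q : Query) (v : ℕ → D) : Set (Fact D) :=
  {φ | ∃ a ∈ Q.body, a.fact ι v = φ}

/-- The frozen body of `Q₂` under `v` is the least database on which `v` produces its answer, and
answers of `Q₁` persist in larger databases. -/
theorem contained_iff {Q₁ Q₂ : Query} : Q₂.Contained ι Q₁ ↔
    ∀ v : ℕ → D, (∀ a ∈ Q₂.acs, a.Holds ι v) →
      Q₂.head.map (Term.eval ι v) ∈ Q₁.answer ι (Q₂.canonical ι v) := by
  constructor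
  · intro h v hv
    refine h _ ?_ ⟨v, fun a ha => ⟨a, ha, rfl⟩, hv, rfl⟩
    exact (List.finite_toSet Q₂.body).image (Atom.fact ι v)
  · rintro h db - t ⟨v, hb, hv, rfl⟩
    obtain ⟨w, hw, hw', he⟩ := h v hv
    refine ⟨w, fun a ha => ?_, hw', he⟩
    obtain ⟨b, hb', e⟩ := hw a ha
    exact e ▸ hb b hb'

/-- Encoding of a pair of queries. -/
def encPair (Q₁ Q₂ : Query) : Data := .pair Q₁.enc Q₂.enc

/-- A mapping modulo `L` becomes an honest assignment of `Q₁` once composed with a `v` that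
satisfies `L`. Functionality of `H` makes it well defined, and only the RSI is left unchecked. -/
theorem IsMapping.exists_assignment {l r : CompOp} {Q₁ Q₂ : Query} {H L : Data} {v : ℕ → D}
    (hcl : Q₁.InClass l r) (hl : l = .le ∨ l = .lt) (h : IsMapping l (encPair Q₁ Q₂) H L) (hL : ∀ e ∈ L.elems, FactHolds ι v e.left) :
    ∃ w : ℕ → D, (∀ n, ∀ p ∈ H.elems, p.left = (Term.var n).enc → codeVal ι v p.right = w n) ∧
      Q₂.head.map (Term.eval ι v) = Q₁.head.map (Term.eval ι w) ∧
      (∀ a ∈ Q₁.body, a.fact ι w ∈ Q₂.canonical ι v) ∧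
      ∀ c ∈ Q₁.acs, c.op = l → c.Holds ι w := by
  classical
  obtain ⟨hfun, hhead, hbody, hacs⟩ := h
  have hw : ∃ w : ℕ → D, ∀ n, ∀ p ∈ H.elems, p.left = (Term.var n).enc →
      codeVal ι v p.right = w n := by
    refine ⟨fun n => if h : ∃ p ∈ H.elems, p.left = (Term.var n).enc
      then codeVal ι v h.choose.right else v 0, fun n p hp e => ?_⟩
    have h : ∃ p ∈ H.elems, p.left = (Term.var n).enc := ⟨p, hp, e⟩
    simp only [dif_pos h]
    rw [hfun p hp _ h.choose_spec.1 (e.trans h.choose_spec.2.symm)]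
  obtain ⟨w, hw⟩ := hw
  have hterm : ∀ s t : Term, MatchTerm H L s.enc t.enc → s.eval ι w = t.eval ι v := by
    rintro s t (⟨hs, p, hp, e, h⟩ | ⟨hs, h⟩)
    · obtain n | c := s
      · have := h.codeVal_eq hL
        rw [hw n p hp e] at this
        simpa [Term.eval] using this
      · simp at hs
    · obtain n | c := s
      · simp at hs
      · simpa [Term.eval] using h.codeVal_eq hL
  have hargs : ∀ s t : List Term, MatchArgs H L (encList Term.enc s) (encList Term.enc t) →
      s.map (Term.eval ι w) = t.map (Term.eval ι v) := by
    intro s t h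
    rw [matchArgs_encList] at h
    induction h with
    | nil => rfl
    | cons h _ ih => simp [hterm _ _ h, ih]
  refine ⟨w, hw, (hargs _ _ hhead).symm, fun a ha => ?_, fun c hc hop => ?_⟩
  · obtain ⟨b, hb, e, h⟩ := hbody a.enc (by simpa [encPair, Query.enc] using ⟨a, ha, rfl⟩)
    simp only [encPair, Query.enc, left_pair, right_pair, elems_encList, List.mem_map] at hb
    obtain ⟨b, hb, rfl⟩ := hb
    refine ⟨b, hb, Prod.ext ?_ (hargs _ _ h).symm⟩
    simpa [Atom.enc, Atom.fact] using e.symm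
  · obtain ⟨p, hp, e, h1, h2⟩ := hacs c.enc (by simpa [encPair, Query.enc] using ⟨c, hc, rfl⟩)
      (by rw [← hop]; rfl)
    have hp' := hw c.lhs p hp e
    replace h1 := h1.holds hL
    obtain ⟨-, d, hd⟩ := hcl.1 c hc
    obtain ⟨n, op, t⟩ := c
    simp only at hd hop
    subst hd hop
    simp only [AC.enc, right_pair, factHolds_leFact, codeVal_enc] at h1 h2 hp'
    rw [hp'] at h1
    rcases hl with rfl | rfl
    · exact h1
    · have h2 := (h2 rfl).holds hL
      rw [factHolds_neFact, codeVal_enc, hp'] at h2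
      exact lt_of_le_of_ne h1 h2

/-- The mapping rule is the only one that uses `hno`: the assignment that it induces meets every
requirement but the RSI, so at a counterexample `v` the unique RSI has to fail. -/
theorem Justified.holds {l r : CompOp} {Q₁ Q₂ : Query} {f H L : Data} {v : ℕ → D}
    (hcl : Q₁.InClass l r) (hl : l = .le ∨ l = .lt) (hr : r = .ge ∨ r = .gt)
    (hv : ∀ a ∈ Q₂.acs, a.Holds ι v)
    (hno : Q₂.head.map (Term.eval ι v) ∉ Q₁.answer ι (Q₂.canonical ι v))
    (h : Justified l r (encPair Q₁ Q₂) f H L) (hL : ∀ e ∈ L.elems, FactHolds ι v e.left) :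
    FactHolds ι v f := by
  rcases h with ⟨c, hc, h⟩ | h | h | ⟨hm, h⟩
  · simp only [encPair, Query.enc, right_pair, elems_encList, List.mem_map] at hc
    obtain ⟨c, hc, rfl⟩ := hc
    exact h.holds (hv c hc)
  · exact h.holds v
  · exact h.holds hL
  · obtain ⟨w, hw, hhead, hbody, hacs⟩ := hm.exists_assignment hcl hl hL
    obtain ⟨c, hc, hcr, hcw⟩ : ∃ c ∈ Q₁.acs, c.op = r ∧ ¬ c.Holds ι w := by
      by_contra! hall
      refine hno ⟨w, hbody, fun c hc => ?_, hhead⟩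
      exact (hcl.1 c hc).1.elim (hacs c hc) (hall c hc)
    rcases h with ⟨c', hc', hop, p, hp, e, h⟩ | ⟨h, -⟩
    · simp only [encPair, Query.enc, left_pair, right_pair, elems_encList, List.mem_map] at hc'
      obtain ⟨c', hc', rfl⟩ := hc'
      obtain rfl := hcl.2 c hc c' hc' hcr (CompOp.enc_injective hop)
      have hp' := hw c.lhs p hp e
      obtain ⟨-, d, hd⟩ := hcl.1 c hc
      obtain ⟨n, op, t⟩ := c
      simp only at hd hcr
      subst hd hcr
      simp only [AC.enc, right_pair] at h hp'
      rcases hr with rfl | rfl <;> simp only [AC.Holds, CompOp.Rel, not_le, not_lt,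
        ge_iff_le, gt_iff_lt] at hcw <;> rcases h with rfl | ⟨hg, rfl⟩ <;>
        simp only [factHolds_leFact, factHolds_neFact, codeVal_enc, hp']
      · exact hcw.le
      · exact hcw.ne
      · exact hcw
      · exact absurd hg (by simp)
    · exact absurd (congrArg CompOp.enc hcr) (h c.enc
        (by simpa [encPair, Query.enc] using ⟨c, hc, rfl⟩))

theorem IsRefutation.contained {l r : CompOp} {Q₁ Q₂ : Query} {C : Data}
    (hcl : Q₁.InClass l r) (hl : l = .le ∨ l = .lt) (hr : r = .ge ∨ r = .gt)
    (h : IsRefutation l r (encPair Q₁ Q₂) C) : Q₂.Contained ι Q₁ := by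
  rw [contained_iff]
  intro v hv
  by_contra hno
  -- An entry is justified by the entries behind it, so the induction runs from the tail of the
  -- list.
  have hsound : ∀ C, IsDerivation l r (encPair Q₁ Q₂) C →
      ∀ e ∈ C.elems, FactHolds ι v e.left := by
    intro C
    induction C with
    | int n => simp
    | pair e t _ ih =>
      rintro ⟨h, ht⟩ e' he'
      have ih := ih ht
      rcases List.mem_cons.1 he' with rfl | he'
      · exact h.holds hcl hl hr hv hno ih
      · exact ih e' he'
  obtain ⟨hC, e, he, hf⟩ := h
  have := hsound C hC e he
  rw [hf, factHolds_neFact] at this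
  exact this rfl

end

end CQAC

namespace CQAC

/-! ### Generic order-preserving assignments -/

/-- A preorder extends to a total preorder in which no new pair of equivalent elements arises and
nothing new is put below the elements of the chain `K`. -/
theorem exists_linear_key {α : Type} (R : α → α → Prop) (K : Set α) (hrefl : ∀ a, R a a)
    (htrans : ∀ a b c, R a b → R b c → R a c) (hK : ∀ c ∈ K, ∀ d ∈ K, R c d ∨ R d c) :
    ∃ (β : Type) (_ : LinearOrder β) (key : α → β), (∀ a b, R a b → key a ≤ key b) ∧
      (∀ a b, key a = key b → R a b) ∧ ∀ a, ∀ c ∈ K, key a ≤ key c → R a c := by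
  -- Besides `R`, each `c ∈ K` is put below every `a` with `¬ R a c`, which forces `c` strictly
  -- below `a` in a linear extension. The chain property of `K` gives transitivity and prevents new
  -- equivalences.
  let : Preorder α :=
    { le := fun a b => R a b ∨ ∃ c ∈ K, R a c ∧ ¬ R b c
      le_refl := fun a => Or.inl (hrefl a)
      le_trans := by
        rintro a b d (h | ⟨c, hc, h, hn⟩) (h' | ⟨c', hc', h', hn'⟩)
        · exact Or.inl (htrans _ _ _ h h')
        · exact Or.inr ⟨c', hc', htrans _ _ _ h h', hn'⟩
        · exact Or.inr ⟨c, hc, h, fun hd => hn (htrans _ _ _ h' hd)⟩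
        · refine Or.inr ⟨c', hc', ?_, hn'⟩
          rcases hK c hc c' hc' with hcc | hcc
          · exact htrans _ _ _ h hcc
          · exact absurd (htrans _ _ _ h' hcc) hn }
  have hle : ∀ a b : α, a ≤ b ↔ (R a b ∨ ∃ c ∈ K, R a c ∧ ¬ R b c) := fun _ _ => Iff.rfl
  have hanti : ∀ a b : α, a ≤ b → b ≤ a → R a b := by
    rintro a b (h | ⟨c, hc, h, hn⟩) h'
    · exact h
    · rcases h' with h' | ⟨c', hc', h', hn'⟩
      · exact absurd (htrans _ _ _ h' h) hn
      · rcases hK c hc c' hc' with hcc | hcc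
        · exact absurd (htrans _ _ _ h hcc) hn'
        · exact absurd (htrans _ _ _ h' hcc) hn
  let key : α → LinearExtension (Antisymmetrization α (· ≤ ·)) :=
    fun a => toLinearExtension (toAntisymmetrization (· ≤ ·) a)
  have hmono : ∀ a b : α, a ≤ b → key a ≤ key b := fun a b h =>
    toLinearExtension.monotone (toAntisymmetrization_le_toAntisymmetrization_iff.2 h)
  have hinj : ∀ a b : α, key a = key b → R a b := fun a b h => by
    have h' : toAntisymmetrization (· ≤ ·) a = toAntisymmetrization (· ≤ ·) b := h
    exact hanti _ _ (toAntisymmetrization_le_toAntisymmetrization_iff.1 h'.le)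
      (toAntisymmetrization_le_toAntisymmetrization_iff.1 h'.ge)
  refine ⟨_, inferInstance, key, fun a b h => hmono a b (Or.inl h), hinj, fun a c hc h => ?_⟩
  by_contra hn
  exact hn (hinj a c (le_antisymm h (hmono c a (Or.inr ⟨c, hc, hrefl c, hn⟩))))

/-- Points of `T` are added one at a time; density and the absence of endpoints leave room between
the images of the smaller and of the larger points. In the application `S` holds the constants,
whose values are prescribed. -/
theorem exists_strictMonoOn_extension {β D : Type*} [LinearOrder β] [LinearOrder D]
    [DenselyOrdered D] [NoMinOrder D] [NoMaxOrder D] [Nonempty D] (S T : Finset β) (f : β → D)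
    (hf : StrictMonoOn f S) : ∃ g : β → D, StrictMonoOn g (S ∪ T : Set β) ∧ Set.EqOn g f S := by
  classical
  induction T using Finset.induction_on with
  | empty => exact ⟨f, by simpa using hf, fun _ _ => rfl⟩
  | insert b T _ ih =>
    obtain ⟨g, hg, he⟩ := ih
    by_cases hb : b ∈ (S ∪ T : Set β)
    · refine ⟨g, hg.mono ?_, he⟩
      rw [Finset.coe_insert, Set.union_insert, Set.insert_eq_of_mem hb]
    · obtain ⟨d, h1, h2⟩ := Order.exists_between_finsets
        (((S ∪ T).filter (· < b)).image g) (((S ∪ T).filter (b < ·)).image g) (by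
          simp only [Finset.mem_image, Finset.mem_filter, Finset.mem_union]
          rintro _ ⟨x, ⟨hx, hxb⟩, rfl⟩ _ ⟨y, ⟨hy, hby⟩, rfl⟩
          exact hg hx hy (hxb.trans hby))
      have hne : ∀ x ∈ (S ∪ T : Set β), x ≠ b := fun x hx e => hb (e ▸ hx)
      refine ⟨Function.update g b d, ?_, fun x hx => ?_⟩
      · rw [Finset.coe_insert, Set.union_insert]
        rintro x (rfl | hx) y (rfl | hy) hxy
        · exact absurd hxy (lt_irrefl _)
        · rw [Function.update_self, Function.update_of_ne (hne y hy)]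
          exact h2 _ (Finset.mem_image_of_mem _ (Finset.mem_filter.2
            ⟨by simpa using hy, hxy⟩))
        · rw [Function.update_self, Function.update_of_ne (hne x hx)]
          exact h1 _ (Finset.mem_image_of_mem _ (Finset.mem_filter.2
            ⟨by simpa using hx, hxy⟩))
        · rw [Function.update_of_ne (hne x hx), Function.update_of_ne (hne y hy)]
          exact hg hx hy hxy
      · rw [Function.update_of_ne (hne x (Or.inl hx)), he hx]

/-- A preorder on finitely many terms that orders the constants as usual is respected by some
assignment that makes no other terms equal, and puts no other terms below constants. -/
theorem exists_generic_assignment {D : Type*} [LinearOrder D] [DenselyOrdered D] [NoMinOrder D]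
    [NoMaxOrder D] (ι : ℚ ↪o D) (U : Finset Term) (R : Term → Term → Prop)
    (hrefl : ∀ a ∈ U, R a a) (htrans : ∀ a ∈ U, ∀ b ∈ U, ∀ c ∈ U, R a b → R b c → R a c)
    (hconst : ∀ c d, .const c ∈ U → .const d ∈ U → (R (.const c) (.const d) ↔ c ≤ d)) :
    ∃ v : ℕ → D, (∀ a ∈ U, ∀ b ∈ U, R a b → a.eval ι v ≤ b.eval ι v) ∧
      (∀ a ∈ U, ∀ b ∈ U, a.eval ι v = b.eval ι v → R a b) ∧
      ∀ a ∈ U, ∀ c, .const c ∈ U → a.eval ι v ≤ ι c → R a (.const c) := by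
  classical
  have : Nonempty D := ⟨ι 0⟩
  obtain ⟨β, _, key, hmono, hinj, hK⟩ := exists_linear_key (α := {t // t ∈ U})
    (fun a b => R a b) {a | ∃ c, a.1 = .const c} (fun a => hrefl a a.2)
    (fun a b c => htrans a a.2 b b.2 c c.2) (by
      rintro ⟨c, hc⟩ ⟨c, rfl⟩ ⟨d, hd⟩ ⟨d, rfl⟩
      simp only [hconst _ _ hc hd, hconst _ _ hd hc]
      exact le_total c d)
  let isC : {t // t ∈ U} → Prop := fun a => ∃ c, a.1 = .const c
  let f : β → D := fun b => if h : ∃ c, ∃ hc : .const c ∈ U, key ⟨.const c, hc⟩ = b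
    then ι h.choose else ι 0
  have hlt : ∀ c d (hc : .const c ∈ U) (hd : .const d ∈ U),
      key ⟨.const c, hc⟩ ≤ key ⟨.const d, hd⟩ → c ≤ d := fun c d hc hd h =>
    (hconst c d hc hd).1 (hK _ ⟨.const d, hd⟩ ⟨d, rfl⟩ h)
  have hf : ∀ c (hc : .const c ∈ U), f (key ⟨.const c, hc⟩) = ι c := by
    intro c hc
    have h : ∃ d, ∃ hd : .const d ∈ U, key ⟨.const d, hd⟩ = key ⟨.const c, hc⟩ := ⟨c, hc, rfl⟩
    obtain ⟨hd, e⟩ := h.choose_spec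
    simp only [f, dif_pos h]
    exact congrArg ι (le_antisymm (hlt _ _ hd hc e.le) (hlt _ _ hc hd e.ge))
  obtain ⟨g, hg, he⟩ := exists_strictMonoOn_extension
    ((U.attach.filter isC).image key) (U.attach.image key) f (by
      simp only [Finset.coe_image, Finset.coe_filter, Finset.mem_attach, true_and]
      rintro _ ⟨⟨c, hc⟩, ⟨c, rfl⟩, rfl⟩ _ ⟨⟨d, hd⟩, ⟨d, rfl⟩, rfl⟩ h
      rw [hf, hf, OrderEmbedding.lt_iff_lt]
      by_contra! hn
      exact absurd (hmono _ _ ((hconst d c hd hc).2 hn)) (not_le.2 h))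
  have hgU : ∀ a b : {t // t ∈ U}, g (key a) ≤ g (key b) ↔ key a ≤ key b := fun a b =>
    hg.le_iff_le (Or.inr (by simp)) (Or.inr (by simp))
  let v : ℕ → D := fun n => if h : .var n ∈ U then g (key ⟨.var n, h⟩) else ι 0
  have hv : ∀ a (ha : a ∈ U), a.eval ι v = g (key ⟨a, ha⟩) := by
    rintro (n | c) ha
    · simp [Term.eval, v, ha]
    · have := he (x := key ⟨.const c, ha⟩) (by
        simp only [Finset.coe_image, Finset.coe_filter, Finset.mem_attach, true_and]
        exact ⟨_, ⟨c, rfl⟩, rfl⟩)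
      rw [this, hf, Term.eval]
  refine ⟨v, fun a ha b hb h => ?_, fun a ha b hb h => ?_, fun a ha c hc h => ?_⟩
  · rw [hv a ha, hv b hb, hgU]
    exact hmono _ _ h
  · rw [hv a ha, hv b hb] at h
    exact hinj ⟨a, ha⟩ ⟨b, hb⟩ (le_antisymm ((hgU _ _).1 h.le) ((hgU _ _).1 h.ge))
  · have h' : a.eval ι v ≤ (Term.const c).eval ι v := h
    rw [hv a ha, hv _ hc, hgU] at h'
    exact hK ⟨a, ha⟩ ⟨.const c, hc⟩ ⟨c, rfl⟩ h'

end CQAC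

namespace CQAC

open Machine Machine.Data

/-! ### Saturated derivations -/

/-- All data occurring in a datum. -/
def subdata : Data → List Data
  | .int n => [.int n]
  | .pair a b => .pair a b :: (subdata a ++ subdata b)

theorem mem_subdata_self (x : Data) : x ∈ subdata x := by
  cases x <;> simp [subdata]

theorem length_subdata_le (x : Data) : (subdata x).length ≤ x.size := by
  induction x with
  | int n => simp [subdata, Data.size]
  | pair a b iha ihb => simp only [subdata, List.length_cons, List.length_append, Data.size]; omega

theorem size_le_of_mem_subdata {x y : Data} (h : y ∈ subdata x) : y.size ≤ x.size := by
  induction x with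
  | int n => simp only [subdata, List.mem_singleton] at h; rw [h]
  | pair a b iha ihb =>
    simp only [subdata, List.mem_cons, List.mem_append] at h
    rcases h with rfl | h | h
    · exact le_rfl
    · have := iha h; simp only [Data.size]; omega
    · have := ihb h; simp only [Data.size]; omega

theorem mem_subdata_trans {x y z : Data} (h : x ∈ subdata y) (h' : y ∈ subdata z) :
    x ∈ subdata z := by
  induction z with
  | int n => simp only [subdata, List.mem_singleton] at h'; rwa [← h']
  | pair a b iha ihb =>
    simp only [subdata, List.mem_cons, List.mem_append] at h' ⊢
    rcases h' with rfl | h' | h'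
    · simpa [subdata] using h
    · exact Or.inr (Or.inl (iha h'))
    · exact Or.inr (Or.inr (ihb h'))

theorem mem_subdata_left {x a b : Data} (h : x ∈ subdata a) : x ∈ subdata (.pair a b) := by
  simp [subdata, h]

theorem mem_subdata_right {x a b : Data} (h : x ∈ subdata b) : x ∈ subdata (.pair a b) := by
  simp [subdata, h]

theorem mem_subdata_encList {α : Type} {f : α → Data} {l : List α} {a : α} (h : a ∈ l) :
    f a ∈ subdata (encList f l) := by
  induction l with
  | nil => simp at h
  | cons b l ih =>
    rcases List.mem_cons.1 h with rfl | h
    · exact mem_subdata_left (mem_subdata_self _)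
    · exact mem_subdata_right (ih h)

theorem size_encList_le {α : Type} {f : α → Data} {l : List α} {K : ℕ}
    (h : ∀ a ∈ l, (f a).size ≤ K) : (encList f l).size ≤ 1 + l.length * (1 + K) := by
  induction l with
  | nil => simp [encList]
  | cons a l ih =>
    have h1 := h a (by simp)
    have h2 := ih fun b hb => h b (by simp [hb])
    rw [List.length_cons, add_mul, one_mul]
    simp only [encList, Data.size]
    omega

/-- A bound on the size of hints. -/
noncomputable def hintBound : Polynomial ℕ := 1 + Polynomial.X * (2 + 2 * Polynomial.X)

/-- A bound on the size of derivations. -/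
noncomputable def derivationBound : Polynomial ℕ :=
  1 + (Polynomial.X ^ 2 + Polynomial.X ^ 2) * (1 + (5 + 2 * Polynomial.X + hintBound))

theorem one_le_eval_hintBound (n : ℕ) : 1 ≤ hintBound.eval n := by
  simp [hintBound]

/-- The graph of a function on the data occurring in `x`. -/
def hint (x : Data) (h : Data → Data) : Data := encList (fun u => .pair u (h u)) (subdata x)

theorem size_hint_le {x : Data} {h : Data → Data} (hh : ∀ u ∈ subdata x, h u ∈ subdata x) :
    (hint x h).size ≤ hintBound.eval x.size := by
  refine (size_encList_le (K := 1 + 2 * x.size) fun u hu => ?_).trans ?_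
  · have := size_le_of_mem_subdata hu
    have := size_le_of_mem_subdata (hh u hu)
    simp only [Data.size]; omega
  · simp only [hintBound, Polynomial.eval_add, Polynomial.eval_one, Polynomial.eval_mul,
      Polynomial.eval_X, Polynomial.eval_ofNat]
    exact Nat.add_le_add_left (Nat.mul_le_mul (length_subdata_le x) (by omega)) 1

/-- The possible facts about data occurring in `x`. -/
def factsOn (x : Data) : Finset Data :=
  ((subdata x).toFinset ×ˢ (subdata x).toFinset).image (fun p => leFact p.1 p.2) ∪
    ((subdata x).toFinset ×ˢ (subdata x).toFinset).image (fun p => neFact p.1 p.2)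

theorem mem_factsOn {x f : Data} : f ∈ factsOn x ↔
    ∃ a ∈ subdata x, ∃ b ∈ subdata x, f = leFact a b ∨ f = neFact a b := by
  simp only [factsOn, Finset.mem_union, Finset.mem_image, Finset.mem_product, List.mem_toFinset,
    Prod.exists]
  constructor
  · rintro (⟨a, b, ⟨ha, hb⟩, rfl⟩ | ⟨a, b, ⟨ha, hb⟩, rfl⟩)
    · exact ⟨a, ha, b, hb, Or.inl rfl⟩
    · exact ⟨a, ha, b, hb, Or.inr rfl⟩
  · rintro ⟨a, ha, b, hb, rfl | rfl⟩
    · exact Or.inl ⟨a, b, ⟨ha, hb⟩, rfl⟩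
    · exact Or.inr ⟨a, b, ⟨ha, hb⟩, rfl⟩

theorem card_factsOn_le (x : Data) : (factsOn x).card ≤ x.size ^ 2 + x.size ^ 2 := by
  have h : (subdata x).toFinset.card ≤ x.size :=
    (List.toFinset_card_le _).trans (length_subdata_le x)
  have h2 : ((subdata x).toFinset ×ˢ (subdata x).toFinset).card ≤ x.size ^ 2 := by
    rw [Finset.card_product, sq]
    exact Nat.mul_le_mul h h
  exact (Finset.card_union_le _ _).trans (add_le_add (Finset.card_image_le.trans h2)
    (Finset.card_image_le.trans h2))

theorem size_le_of_mem_factsOn {x f : Data} (h : f ∈ factsOn x) : f.size ≤ 4 + 2 * x.size := by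
  obtain ⟨a, ha, b, hb, rfl | rfl⟩ := mem_factsOn.1 h <;>
  · have := size_le_of_mem_subdata ha
    have := size_le_of_mem_subdata hb
    simp [leFact, neFact, Data.size]
    omega

/-- A derivation of facts about the data occurring in `x` to which nothing can be added, and which
does not contain a contradiction. -/
structure Saturated (l r : CompOp) (x C : Data) : Prop where
  derivation : IsDerivation l r x C
  mem_facts : ∀ e ∈ C.elems, e.left ∈ factsOn x
  size_hint : ∀ e ∈ C.elems, e.right.size ≤ hintBound.eval x.size
  closed : ∀ f ∈ factsOn x, ∀ H : Data, H.size ≤ hintBound.eval x.size →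
    Justified l r x f H C → Known C f
  irrefl : ∀ a, ¬ Known C (neFact a a)

/-- A longest derivation with pairwise distinct facts and bounded hints is closed, since a missing
justified fact would extend it. Distinctness bounds its length by the number of possible facts, so
if it contains a contradiction it is a small refutation. -/
theorem exists_refutation_or_saturated (l r : CompOp) (x : Data) :
    (∃ C : Data, C.size ≤ derivationBound.eval x.size ∧ IsRefutation l r x C) ∨
      ∃ C, Saturated l r x C := by
  let code : List (Data × Data) → Data := encList fun p => .pair p.1 p.2
  let good : List (Data × Data) → Prop := fun C => IsDerivation l r x (code C) ∧
    (C.map Prod.fst).Nodup ∧ (∀ p ∈ C, p.1 ∈ factsOn x) ∧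
    ∀ p ∈ C, p.2.size ≤ hintBound.eval x.size
  have hlen : ∀ C, good C → C.length ≤ (factsOn x).card := by
    rintro C ⟨-, hn, hf, -⟩
    have := Finset.card_le_card (s := (C.map Prod.fst).toFinset) (t := factsOn x) (by
      intro f hf'
      simp only [List.mem_toFinset, List.mem_map] at hf'
      obtain ⟨p, hp, rfl⟩ := hf'
      exact hf p hp)
    rwa [List.toFinset_card_of_nodup hn, List.length_map] at this
  obtain ⟨C, hC, hmax⟩ : ∃ C, good C ∧ ∀ C', good C' → C'.length ≤ C.length := by
    have hne : ∃ n, ∃ C, good C ∧ C.length = n := ⟨0, [], ⟨trivial, by simp, by simp, by simp⟩, rfl⟩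
    have hbdd : BddAbove {n | ∃ C, good C ∧ C.length = n} :=
      ⟨_, by rintro n ⟨C, hC, rfl⟩; exact hlen C hC⟩
    obtain ⟨C, hC, e⟩ := Nat.sSup_mem hne hbdd
    exact ⟨C, hC, fun C' hC' => e ▸ le_csSup hbdd ⟨C', hC', rfl⟩⟩
  have hsize : (code C).size ≤ derivationBound.eval x.size := by
    refine (size_encList_le (K := 5 + 2 * x.size + hintBound.eval x.size) fun p hp => ?_).trans ?_
    · have := size_le_of_mem_factsOn (hC.2.2.1 p hp)
      have := hC.2.2.2 p hp
      simp only [Data.size]; omega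
    · simp only [derivationBound, Polynomial.eval_add, Polynomial.eval_one, Polynomial.eval_mul,
        Polynomial.eval_X, Polynomial.eval_ofNat, Polynomial.eval_pow]
      have := (hlen C hC).trans (card_factsOn_le x)
      gcongr
  by_cases h : ∃ a, Known (code C) (neFact a a)
  · obtain ⟨a, e, he, ha⟩ := h
    exact Or.inl ⟨code C, hsize, hC.1, e, he, by rw [ha]; rfl⟩
  · push Not at h
    refine Or.inr ⟨code C, hC.1, ?_, ?_, fun f hf H hH hj => ?_, h⟩
    · simp only [code, elems_encList, List.mem_map]
      rintro _ ⟨p, hp, rfl⟩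
      exact hC.2.2.1 p hp
    · simp only [code, elems_encList, List.mem_map]
      rintro _ ⟨p, hp, rfl⟩
      exact hC.2.2.2 p hp
    · by_contra hk
      have hk' : f ∉ C.map Prod.fst := fun hm => hk (by
        obtain ⟨p, hp, rfl⟩ := List.mem_map.1 hm
        exact ⟨.pair p.1 p.2, by simp only [code, elems_encList, List.mem_map]; exact ⟨p, hp, rfl⟩, rfl⟩)
      have := hmax ((f, H) :: C) ⟨⟨hj, hC.1⟩, List.nodup_cons.2 ⟨hk', hC.2.1⟩,
        List.forall_mem_cons.2 ⟨hf, hC.2.2.1⟩, List.forall_mem_cons.2 ⟨hH, hC.2.2.2⟩⟩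
      simp at this

/-! ### Laws of order inside a saturated derivation -/

namespace Saturated

variable {l r : CompOp} {x C a b c : Data}

theorem mem_left (h : Saturated l r x C) (hab : Known C (leFact a b)) : a ∈ subdata x := by
  obtain ⟨e, he, hf⟩ := hab
  have := h.mem_facts e he
  rw [hf, mem_factsOn] at this
  simp at this
  tauto

theorem mem_right (h : Saturated l r x C) (hab : Known C (leFact a b)) : b ∈ subdata x := by
  obtain ⟨e, he, hf⟩ := hab
  have := h.mem_facts e he
  rw [hf, mem_factsOn] at this
  simp at this
  tauto

/-- Only the mapping rule reads its hint, so the dummy hint `0` serves for all the others. -/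
theorem le_closed (h : Saturated l r x C) (ha : a ∈ subdata x) (hb : b ∈ subdata x)
    (hj : Justified l r x (leFact a b) (.int 0) C) : Known C (leFact a b) :=
  h.closed _ (mem_factsOn.2 ⟨a, ha, b, hb, Or.inl rfl⟩) (.int 0)
    (by simpa using one_le_eval_hintBound _) hj

theorem ne_closed (h : Saturated l r x C) (ha : a ∈ subdata x) (hb : b ∈ subdata x)
    (hj : Justified l r x (neFact a b) (.int 0) C) : Known C (neFact a b) :=
  h.closed _ (mem_factsOn.2 ⟨a, ha, b, hb, Or.inr rfl⟩) (.int 0)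
    (by simpa using one_le_eval_hintBound _) hj

theorem le_refl (h : Saturated l r x C) (ha : a ∈ subdata x) : Known C (leFact a a) :=
  h.le_closed ha ha (Or.inr (Or.inr (Or.inl (Or.inl rfl))))

theorem le_trans (h : Saturated l r x C) (hab : Known C (leFact a b))
    (hbc : Known C (leFact b c)) : Known C (leFact a c) := by
  obtain ⟨e, he, hf⟩ := id hab
  refine h.le_closed (h.mem_left hab) (h.mem_right hbc) (Or.inr (Or.inr (Or.inl (Or.inr
    (Or.inl ⟨rfl, e, he, ?_⟩)))))
  rw [hf]
  exact ⟨hab, hbc⟩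

theorem ne_of_between (h : Saturated l r x C) {u w : Data} (hn : Known C (neFact u w))
    (h1 : Known C (leFact a u)) (h2 : Known C (leFact u b)) (h3 : Known C (leFact a w))
    (h4 : Known C (leFact w b)) : Known C (neFact a b) := by
  obtain ⟨e, he, hf⟩ := id hn
  refine h.ne_closed (h.mem_left h1) (h.mem_right h2) (Or.inr (Or.inr (Or.inl (Or.inr
    (Or.inr ⟨rfl, e, he, ?_⟩)))))
  rw [hf]
  exact ⟨hn, ⟨h1, h2⟩, h3, h4⟩

theorem ne_symm (h : Saturated l r x C) (hn : Known C (neFact a b))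
    (hba : Known C (leFact b a)) : Known C (neFact b a) :=
  h.ne_of_between hn hba (h.le_refl (h.mem_right hba)) (h.le_refl (h.mem_left hba)) hba

end Saturated

end CQAC

namespace CQAC

open Machine Machine.Data

/-! ### Models of saturated derivations -/

/-- `a ≤ b` is listed in `C`. -/
def LeIn (C : Data) (a b : Term) : Prop := Known C (leFact a.enc b.enc)

/-- `a ≠ b` is listed in `C`. -/
def NeIn (C : Data) (a b : Term) : Prop := Known C (neFact a.enc b.enc)

theorem enc_mem_subdata_of_mem_head {Q : Query} {t : Term} (h : t ∈ Q.head) :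
    t.enc ∈ subdata Q.enc :=
  mem_subdata_left (mem_subdata_encList h)

theorem enc_mem_subdata_of_mem_body {Q : Query} {t : Term} {a : Atom} (ha : a ∈ Q.body)
    (h : t ∈ a.args) : t.enc ∈ subdata Q.enc :=
  mem_subdata_right (mem_subdata_left (mem_subdata_trans
    (mem_subdata_right (mem_subdata_encList h)) (mem_subdata_encList (f := Atom.enc) ha)))

theorem enc_rhs_mem_subdata {Q : Query} {c : AC} (h : c ∈ Q.acs) :
    c.rhs.enc ∈ subdata Q.enc :=
  mem_subdata_right (mem_subdata_right (mem_subdata_trans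
    (mem_subdata_right (mem_subdata_right (mem_subdata_self _)))
    (mem_subdata_encList (f := AC.enc) h)))

theorem enc_mem_subdata_of_occursInBody {Q : Query} {n : ℕ} (h : Q.OccursInBody n) :
    (Term.var n).enc ∈ subdata Q.enc := by
  obtain ⟨a, ha, h⟩ := h
  exact enc_mem_subdata_of_mem_body ha h

theorem byConstants_leFact {c d : ℚ} (h : c ≤ d) :
    ByConstants (leFact (Term.const c).enc (Term.const d).enc) := by
  refine ⟨⟨rfl, rfl⟩, ⟨(ile_int _ _).2 ?_, (ile_int _ _).2 ?_⟩, Or.inl ⟨rfl, ?_⟩⟩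
  · exact_mod_cast c.den_pos
  · exact_mod_cast d.den_pos
  · simp only [leFact, left_pair, right_pair, Term.enc, imul_eq, toInt_int, ile_int]
    exact (Rat.le_iff c d).1 h

theorem byConstants_neFact {c d : ℚ} (h : c ≠ d) :
    ByConstants (neFact (Term.const c).enc (Term.const d).enc) := by
  refine ⟨⟨rfl, rfl⟩, ⟨(ile_int _ _).2 ?_, (ile_int _ _).2 ?_⟩, Or.inr ⟨rfl, ?_⟩⟩
  · exact_mod_cast c.den_pos
  · exact_mod_cast d.den_pos
  · simp only [neFact, left_pair, right_pair, Term.enc, imul_eq, toInt_int, ne_eq, Data.int.injEq]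
    exact fun e => h (Rat.eq_iff_mul_eq_mul.2 e)

namespace Saturated

variable {l r : CompOp} {Q₁ Q₂ : Query} {C : Data}

/-- A false `c ≤ d`, together with the true facts `d ≤ c` and `c ≠ d`, would yield the contradiction
`c ≠ c`. -/
theorem const_le_iff {x : Data} (h : Saturated l r x C) {c d : ℚ}
    (hc : (Term.const c).enc ∈ subdata x) (hd : (Term.const d).enc ∈ subdata x) :
    LeIn C (.const c) (.const d) ↔ c ≤ d := by
  refine ⟨fun hle => ?_, fun hle => h.le_closed hc hd (Or.inr (Or.inl (byConstants_leFact hle)))⟩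
  by_contra! hlt
  exact h.irrefl _ (h.ne_of_between
    (h.ne_closed hc hd (Or.inr (Or.inl (byConstants_neFact hlt.ne'))))
    (h.le_refl hc) (h.le_refl hc) hle
    (h.le_closed hd hc (Or.inr (Or.inl (byConstants_leFact hlt.le)))))

/-- If `y ≤ c` holds for a constant `c`, but `y ≠ c` is not known, no other constant lies
between. -/
theorem const_eq_of_between {x : Data} (h : Saturated l r x C) {y : Term} {c k : ℚ}
    (hn : ¬ NeIn C y (.const c)) (h1 : LeIn C y (.const k)) (h2 : LeIn C (.const k) (.const c)) :
    k = c := by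
  by_contra hkc
  have hk := h.mem_left h2
  have hc := h.mem_right h2
  exact hn (h.ne_of_between (h.ne_closed hk hc (Or.inr (Or.inl (byConstants_neFact hkc))))
    h1 h2 (h.le_trans h1 h2) (h.le_refl hc))

theorem le_of_comparison (h : Saturated l r (encPair Q₁ Q₂) C) {c : AC} (hc : c ∈ Q₂.acs)
    {a b : Term} (ha : a.enc ∈ subdata (encPair Q₁ Q₂)) (hb : b.enc ∈ subdata (encPair Q₁ Q₂))
    (hf : ByComparison c.enc (leFact a.enc b.enc)) : LeIn C a b :=
  h.le_closed ha hb (Or.inl ⟨c.enc, by simpa [encPair, Query.enc] using ⟨c, hc, rfl⟩, hf⟩)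

theorem ne_of_comparison (h : Saturated l r (encPair Q₁ Q₂) C) {c : AC} (hc : c ∈ Q₂.acs)
    {a b : Term} (ha : a.enc ∈ subdata (encPair Q₁ Q₂)) (hb : b.enc ∈ subdata (encPair Q₁ Q₂))
    (hf : ByComparison c.enc (neFact a.enc b.enc)) : NeIn C a b :=
  h.ne_closed ha hb (Or.inl ⟨c.enc, by simpa [encPair, Query.enc] using ⟨c, hc, rfl⟩, hf⟩)

/-- The order of a derivation, extended by `c ≤ y` for all terms `y` that `P` pins to the constant
`c`. -/
def Pinned (C : Data) (P : Term → ℚ → Prop) (a b : Term) : Prop :=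
  LeIn C a b ∨ ∃ c y, P y c ∧ LeIn C a (.const c) ∧ LeIn C y b

/-! ### Pinning terms to constants -/

section Pinned

variable {P : Term → ℚ → Prop} {x : Data}

/-- If, say, `c ≤ d`, then `z ≤ c ≤ d` while `z ≠ d` is underivable, so `c = d`. Hence pins that are
linked in both directions belong to one constant. -/
theorem pinned_const_eq (h : Saturated l r x C)
    (hP : ∀ y c, P y c → LeIn C y (.const c) ∧ ¬ NeIn C y (.const c)) {y z : Term} {c d : ℚ}
    (hy : P y c) (hz : P z d) (h1 : LeIn C y (.const d)) (h2 : LeIn C z (.const c)) : c = d := by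
  have hc := h.mem_right (hP y c hy).1
  have hd := h.mem_right (hP z d hz).1
  rcases le_total c d with hle | hle
  · exact h.const_eq_of_between (hP z d hz).2 h2 ((h.const_le_iff hc hd).2 hle)
  · exact (h.const_eq_of_between (hP y c hy).2 h1 ((h.const_le_iff hd hc).2 hle)).symm

/-- Two consecutive detours through pins merge into one: their constants are in ascending order, or
else the second lies between `y` and the first, which forces them to coincide. -/
theorem pinned_trans (h : Saturated l r x C)
    (hP : ∀ y c, P y c → LeIn C y (.const c) ∧ ¬ NeIn C y (.const c)) {a b d : Term}
    (hab : Pinned C P a b) (hbd : Pinned C P b d) : Pinned C P a d := by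
  rcases hab with hab | ⟨c, y, hy, hac, hyb⟩ <;> rcases hbd with hbd | ⟨c', y', hy', hbc, hyd⟩
  · exact Or.inl (h.le_trans hab hbd)
  · exact Or.inr ⟨c', y', hy', h.le_trans hab hbc, hyd⟩
  · exact Or.inr ⟨c, y, hy, hac, h.le_trans hyb hbd⟩
  · have hc := h.mem_right hac
    have hc' := h.mem_right hbc
    have hyc : LeIn C y (.const c') := h.le_trans hyb hbc
    rcases le_total c c' with hle | hle
    · exact Or.inr ⟨c', y', hy', h.le_trans hac ((h.const_le_iff hc hc').2 hle), hyd⟩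
    · obtain rfl := h.const_eq_of_between (hP y c hy).2 hyc ((h.const_le_iff hc' hc).2 hle)
      exact Or.inr ⟨c', y', hy', hac, hyd⟩

/-- Pinning raises terms but puts nothing new below a constant. So the constants keep their order,
and bounds by constants in the model are still derived ones. -/
theorem le_const_of_pinned (h : Saturated l r x C)
    (hP : ∀ y c, P y c → LeIn C y (.const c) ∧ ¬ NeIn C y (.const c)) {a : Term} {d : ℚ}
    (hd : (Term.const d).enc ∈ subdata x) (had : Pinned C P a (.const d)) :
    LeIn C a (.const d) := by
  rcases had with had | ⟨c, y, hy, hac, hyd⟩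
  · exact had
  · have hc := h.mem_right hac
    rcases le_total c d with hle | hle
    · exact h.le_trans hac ((h.const_le_iff hc hd).2 hle)
    · rwa [h.const_eq_of_between (hP y c hy).2 hyd ((h.const_le_iff hd hc).2 hle)]

/-- Derived strict inequalities survive pinning: a detour back gives `y ≤ a ≤ b ≤ c` with `a ≠ b`,
whence `y ≠ c`, which the pin excludes. -/
theorem not_pinned_of_lt (h : Saturated l r x C)
    (hP : ∀ y c, P y c → LeIn C y (.const c) ∧ ¬ NeIn C y (.const c)) {a b : Term}
    (hab : LeIn C a b) (hne : NeIn C a b) : ¬ Pinned C P b a := by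
  rintro (hba | ⟨c, y, hy, hbc, hya⟩)
  · have ha := h.mem_left hab
    exact h.irrefl _ (h.ne_of_between hne (h.le_refl ha) (h.le_refl ha) hab hba)
  · exact (hP y c hy).2 (h.ne_of_between hne hya (h.le_trans hab hbc) (h.le_trans hya hab) hbc)

variable {D : Type*} [LinearOrder D] [DenselyOrdered D] [NoMinOrder D] [NoMaxOrder D] (ι : ℚ ↪o D)

/-- A saturated derivation has a model that is generic up to pinning terms to constants. -/
theorem exists_model (h : Saturated l r (encPair Q₁ Q₂) C) (hQ : Q₂.WellFormed ι)
    (hP : ∀ y c, P y c → LeIn C y (.const c) ∧ ¬ NeIn C y (.const c))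
    (hne : ∀ X Y, (⟨X, .ne, .var Y⟩ : AC) ∈ Q₂.acs → NeIn C (.var X) (.var Y) →
      ∀ y z c, P y c → P z c → LeIn C y (.var X) → LeIn C (.var X) (.const c) →
      LeIn C z (.var Y) → LeIn C (.var Y) (.const c) → False) :
    ∃ v : ℕ → D, (∀ c ∈ Q₂.acs, c.Holds ι v) ∧
      (∀ a b, LeIn C a b → a.eval ι v ≤ b.eval ι v) ∧
      (∀ a b, LeIn C a b → NeIn C a b → a.eval ι v < b.eval ι v) ∧
      (∀ a b : Term, a.enc ∈ subdata (encPair Q₁ Q₂) → b.enc ∈ subdata (encPair Q₁ Q₂) →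
        a.eval ι v = b.eval ι v → Pinned C P a b) ∧
      (∀ a b c, Pinned C P a b → a = .const c → b.enc ∈ subdata (encPair Q₁ Q₂) →
        ι c ≤ b.eval ι v) ∧
      ∀ (a : Term) (c : ℚ), a.enc ∈ subdata (encPair Q₁ Q₂) →
        (Term.const c).enc ∈ subdata (encPair Q₁ Q₂) →
        a.eval ι v ≤ ι c → LeIn C a (.const c) := by
  let U : Finset Term := (subdata (encPair Q₁ Q₂)).toFinset.preimage Term.enc
    Term.enc_injective.injOn
  have hU : ∀ a, a ∈ U ↔ a.enc ∈ subdata (encPair Q₁ Q₂) := fun a => by simp [U]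
  obtain ⟨v, hmono, hinj, hconst⟩ := exists_generic_assignment ι U (Pinned C P)
    (fun a ha => Or.inl (h.le_refl ((hU a).1 ha))) (fun a _ b _ c _ => h.pinned_trans hP)
    (fun c d hc hd => by
      rw [← h.const_le_iff ((hU _).1 hc) ((hU _).1 hd)]
      exact ⟨h.le_const_of_pinned hP ((hU _).1 hd), Or.inl⟩)
  have hle : ∀ a b, LeIn C a b → a.eval ι v ≤ b.eval ι v := fun a b hab =>
    hmono a ((hU a).2 (h.mem_left hab)) b ((hU b).2 (h.mem_right hab)) (Or.inl hab)
  have hlt : ∀ a b, LeIn C a b → NeIn C a b → a.eval ι v < b.eval ι v := fun a b hab hn =>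
    lt_of_le_of_ne (hle a b hab) fun e => h.not_pinned_of_lt hP hab hn
      (hinj b ((hU b).2 (h.mem_right hab)) a ((hU a).2 (h.mem_left hab)) e.symm)
  refine ⟨v, fun c hc => ?_, hle, hlt, fun a b ha hb e => hinj a ((hU a).2 ha) b ((hU b).2 hb) e,
    ?_, fun a c ha hc hac => h.le_const_of_pinned hP hc (hconst a ((hU a).2 ha) c ((hU _).2 hc) hac)⟩
  · have hX : (Term.var c.lhs).enc ∈ subdata (encPair Q₁ Q₂) :=
      mem_subdata_right (enc_mem_subdata_of_occursInBody (hQ.lhs_safe c hc))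
    have ht : c.rhs.enc ∈ subdata (encPair Q₁ Q₂) := mem_subdata_right (enc_rhs_mem_subdata hc)
    have hle1 := fun hf => hle _ _ (h.le_of_comparison hc hX ht hf)
    have hle2 := fun hf => hle _ _ (h.le_of_comparison hc ht hX hf)
    have hne1 := fun hf => h.ne_of_comparison hc hX ht hf
    obtain ⟨X, op, t⟩ := c
    cases op
    · exact hlt _ _ (h.le_of_comparison hc hX ht (Or.inl ⟨rfl, by simp [AC.enc]⟩))
        (hne1 (Or.inr (Or.inr ⟨rfl, by simp [AC.enc]⟩)))
    · exact hle1 (Or.inl ⟨rfl, by simp [AC.enc]⟩)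
    · have htX := h.le_of_comparison hc ht hX (Or.inr (Or.inl ⟨rfl, by simp [AC.enc]⟩))
      exact hlt _ _ htX (h.ne_symm (hne1 (Or.inr (Or.inr ⟨rfl, by simp [AC.enc]⟩))) htX)
    · exact hle2 (Or.inr (Or.inl ⟨rfl, by simp [AC.enc]⟩))
    · exact le_antisymm (hle1 (Or.inl ⟨rfl, by simp [AC.enc]⟩))
        (hle2 (Or.inr (Or.inl ⟨rfl, by simp [AC.enc]⟩)))
    · have hn : NeIn C (.var X) t := hne1 (Or.inr (Or.inr ⟨rfl, by simp [AC.enc]⟩))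
      intro e
      have h1 := hinj (.var X) ((hU _).2 hX) t ((hU _).2 ht) e
      have h2 := hinj t ((hU _).2 ht) (.var X) ((hU _).2 hX) e.symm
      -- If either inequality is derived outright, it is strict and cannot be reversed. Otherwise
      -- both sides lie between pinned terms and a common constant: `hne` excludes this for two
      -- variables, and a constant side would equal the pin's constant.
      rcases id h1 with h1' | ⟨c, y, hy, hXc, hyt⟩
      · exact h.not_pinned_of_lt hP h1' hn h2
      rcases id h2 with h2' | ⟨d, z, hz, htd, hzX⟩
      · exact h.not_pinned_of_lt hP h2' (h.ne_symm hn h2') h1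
      obtain rfl : c = d := h.pinned_const_eq hP hy hz (h.le_trans hyt htd) (h.le_trans hzX hXc)
      rcases t with Y | k
      · exact hne X Y hc hn z y c hz hy hzX hXc hyt htd
      · obtain rfl := h.const_eq_of_between (hP y c hy).2 hyt htd
        exact h.not_pinned_of_lt hP hXc hn h2
  · rintro a b c hab rfl hb
    refine hmono (.const c) ((hU _).2 ?_) b ((hU b).2 hb) hab
    rcases hab with hab | ⟨d, y, -, hab, -⟩ <;> exact h.mem_left hab

end Pinned

/-- Known facts occur only positively, so a mapping used early in a derivation can be reused with
all of its facts. -/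
theorem isMapping_mono {x H L : Data} (hLC : ∀ f, Known L f → Known C f)
    (h : IsMapping l x H L) : IsMapping l x H C := by
  have hterm : ∀ s t, MatchTerm H L s t → MatchTerm H C s t := by
    rintro s t (⟨hs, p, hp, e, h1, h2⟩ | ⟨hs, h1, h2⟩)
    · exact Or.inl ⟨hs, p, hp, e, hLC _ h1, hLC _ h2⟩
    · exact Or.inr ⟨hs, hLC _ h1, hLC _ h2⟩
  have hargs : ∀ s t, MatchArgs H L s t → MatchArgs H C s t := by
    intro s
    induction s with
    | int n => exact fun t h => h
    | pair a s _ ih => exact fun t h => ⟨⟨h.1.1, hterm _ _ h.1.2⟩, ih _ h.2⟩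
  obtain ⟨h1, h2, h3, h4⟩ := h
  refine ⟨h1, hargs _ _ h2, fun a ha => ?_, fun c hc hop => ?_⟩
  · obtain ⟨b, hb, e, hm⟩ := h3 a ha
    exact ⟨b, hb, e, hargs _ _ hm⟩
  · obtain ⟨p, hp, e, hle, hne⟩ := h4 c hc hop
    exact ⟨p, hp, e, hLC _ hle, fun hl => hLC _ (hne hl)⟩

variable {D : Type*} [LinearOrder D]

/-- A derived inequality is implied by the comparisons of the second query, or it passes through
the constant of the right semi-interval of the first query. -/
theorem le_cases {ι : ℚ ↪o D} (h : Saturated l r (encPair Q₁ Q₂) C) {a b : Data}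
    (hab : Known C (leFact a b)) :
    (∀ v : ℕ → D, (∀ c ∈ Q₂.acs, c.Holds ι v) → codeVal ι v a ≤ codeVal ι v b) ∨
    ∃ c ∈ Q₁.acs, c.op = r ∧ Known C (leFact a c.rhs.enc) ∧
      (r = .ge → Known C (neFact a c.rhs.enc)) ∧ Known C (leFact c.rhs.enc b) := by
  suffices key : ∀ L, IsDerivation l r (encPair Q₁ Q₂) L → (∀ e ∈ L.elems, e ∈ C.elems) →
      ∀ a b, Known L (leFact a b) →
      (∀ v : ℕ → D, (∀ c ∈ Q₂.acs, c.Holds ι v) → codeVal ι v a ≤ codeVal ι v b) ∨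
      ∃ c ∈ Q₁.acs, c.op = r ∧ Known C (leFact a c.rhs.enc) ∧
        (r = .ge → Known C (neFact a c.rhs.enc)) ∧ Known C (leFact c.rhs.enc b) from
    key C h.derivation (fun _ he => he) a b hab
  intro L
  induction L with
  | int n => rintro - - a b ⟨e, he, -⟩; simp at he
  | pair e L _ ih =>
    rintro ⟨hj, hL⟩ hsub a b ⟨e', he', hf⟩
    have hsub' : ∀ e ∈ L.elems, e ∈ C.elems := fun e he => hsub e (by simp [he])
    have ih := ih hL hsub'
    have hLC : ∀ f, Known L f → Known C f := fun f ⟨e, he, hf⟩ => ⟨e, hsub' e he, hf⟩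
    rcases List.mem_cons.1 he' with rfl | he'
    swap
    · exact ih a b ⟨e', he', hf⟩
    have heC := hsub e' (by simp)
    rw [hf] at hj
    rcases hj with ⟨c, hc, hj⟩ | hj | hj | ⟨hm, hj⟩
    · left
      intro v hv
      simp only [encPair, Query.enc, right_pair, elems_encList, List.mem_map] at hc
      obtain ⟨c, hc, rfl⟩ := hc
      exact (factHolds_leFact ..).1 (hj.holds (hv c hc))
    · exact Or.inl fun v _ => (factHolds_leFact ..).1 (hj.holds v)
    · rcases hj with hj | ⟨-, g, -, h1, h2⟩ | ⟨hj, -⟩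
      · left
        intro v _
        rw [leFact_inj] at hj
        rw [hj.2]
        exact le_rfl
      · rw [right_pair] at h1 h2
        rcases ih _ _ h1 with h1' | ⟨c, hc, hop, hac, hn, hcm⟩
        · rcases ih _ _ h2 with h2' | ⟨c, hc, hop, hmc, hn, hcb⟩
          · exact Or.inl fun v hv => (h1' v hv).trans (h2' v hv)
          -- The RSI is used in the second half of the chain; a fact `m ≠ c` then passes to `a ≠ c`
          -- along `a ≤ m ≤ c`.
          · have hac := h.le_trans (hLC _ h1) hmc
            exact Or.inr ⟨c, hc, hop, hac, fun hr => h.ne_of_between (hn hr) (hLC _ h1) hmc hac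
              (h.le_refl (h.mem_right hmc)), hcb⟩
        · exact Or.inr ⟨c, hc, hop, hac, hn, h.le_trans hcm (hLC _ h2)⟩
      · exact absurd hj leFact_ne_neFact
    · rcases hj with ⟨c, hc, hop, p, hp, hpc, hj⟩ | ⟨-, hj⟩
      swap
      · exact absurd hj leFact_ne_neFact
      have hj : leFact a b = leFact p.right c.right.right :=
        hj.resolve_right fun hj => leFact_ne_neFact hj.2
      rw [leFact_inj] at hj
      obtain ⟨rfl, rfl⟩ := hj
      have hle : Known C (leFact p.right c.right.right) := ⟨e', heC, hf⟩
      have hmem := hc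
      simp only [encPair, Query.enc, left_pair, right_pair, elems_encList, List.mem_map] at hc
      obtain ⟨c, hc, rfl⟩ := hc
      refine Or.inr ⟨c, hc, CompOp.enc_injective hop, hle, fun hr => ?_,
        h.le_refl (h.mem_right hle)⟩
      -- The failure of a closed RSI is strict, and the same hint justifies its `≠` half, which
      -- saturation therefore lists.
      exact h.closed _ (mem_factsOn.2 ⟨_, h.mem_left hle, _, h.mem_right hle, Or.inr rfl⟩)
        e'.right (h.size_hint e' heC) (Or.inr (Or.inr (Or.inr ⟨isMapping_mono hLC hm,
          Or.inl ⟨c.enc, hmem, hop, p, hp, hpc, Or.inr ⟨hr, rfl⟩⟩⟩)))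

/-- If `X ≤ c` were derived through the RSI, the RSI constant would be `c` itself: a closed RSI
would then give `X ≠ c`, and an open one is excluded by `hc`. So `Q₂` alone implies `X ≤ c`. The
model pinning only `X` to `c` refutes `X < c`, and the model without pins refutes `X = c`. -/
theorem closedLSI {ι : ℚ ↪o D} [DenselyOrdered D] [NoMinOrder D] [NoMaxOrder D]
    (h : Saturated l r (encPair Q₁ Q₂) C) (hQ : Q₂.WellFormed ι) (hcl : Q₁.InClass l r)
    (hr : r = .ge ∨ r = .gt) {X : ℕ} {c : ℚ} (hle : LeIn C (.var X) (.const c))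
    (hne : ¬ NeIn C (.var X) (.const c)) (hge : ¬ LeIn C (.const c) (.var X))
    (hc : r = .gt → ¬ Q₁.OpenRSIConst c) : ClosedLSI ι Q₂.acs X c := by
  have hX := h.mem_left hle
  have hcU := h.mem_right hle
  refine ⟨?_, ?_, ?_⟩
  · rcases h.le_cases (ι := ι) hle with himp | ⟨d, hd, hop, hXd, hn, hdc⟩
    · intro v hv
      have := himp v hv
      rwa [codeVal_enc, codeVal_enc] at this
    · exfalso
      obtain ⟨-, k, hk⟩ := hcl.1 d hd
      rw [hk] at hXd hn hdc
      obtain rfl := h.const_eq_of_between hne hXd hdc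
      rcases hr with rfl | rfl
      · exact hne (hn rfl)
      · refine hc rfl ⟨d.lhs, ?_⟩
        rw [← hk, ← hop]
        exact hd
  · obtain ⟨v, hv, hmono, -, -, hpin, -⟩ := h.exists_model ι hQ
      (P := fun y k => y = .var X ∧ k = c)
      (by rintro y k ⟨rfl, rfl⟩; exact ⟨hle, hne⟩)
      (by
        rintro Y Z - hn y z k ⟨rfl, rfl⟩ ⟨rfl, -⟩ h1 h2 h3 h4
        exact hne (h.ne_of_between hn h1 h2 h3 h4))
    intro himp
    have h1 : v X < ι c := himp v hv
    have h2 : ι c ≤ v X := hpin (.const c) (.var X) c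
      (Or.inr ⟨c, .var X, ⟨rfl, rfl⟩, h.le_refl hcU, h.le_refl hX⟩) rfl hX
    exact absurd h1 (not_lt.2 h2)
  · obtain ⟨v, hv, -, -, hinj, -⟩ := h.exists_model ι hQ (P := fun _ _ => False)
      (by simp) (by simp)
    intro himp
    have h1 : v X = ι c := himp v hv
    rcases hinj (.const c) (.var X) hcU hX h1.symm with h2 | ⟨_, _, h2, -⟩
    · exact hge h2
    · exact h2

end Saturated

end CQAC

namespace CQAC

open Machine Machine.Data

/-! ### Completeness of derivations -/

/-- Substitution of terms for variables. -/
def Term.subst (g : ℕ → Term) : Term → Term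
  | .var n => g n
  | .const c => .const c

theorem Term.eval_subst {D : Type*} [LinearOrder D] {ι : ℚ ↪o D} {v w : ℕ → D} {g : ℕ → Term}
    {s : Term} (h : ∀ n, s = .var n → (g n).eval ι v = w n) :
    (s.subst g).eval ι v = s.eval ι w := by
  cases s
  · exact h _ rfl
  · rfl

theorem forall₂_of_map_eq {α β γ : Type*} {f : α → γ} {g : β → γ} {s : List α} {t : List β}
    (h : s.map f = t.map g) : List.Forall₂ (fun a b => a ∈ s ∧ b ∈ t ∧ f a = g b) s t := by
  induction s generalizing t with
  | nil => cases t <;> simp at h ⊢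
  | cons a s ih =>
    cases t with
    | nil => simp at h
    | cons b t =>
      simp only [List.map_cons, List.cons.injEq] at h
      exact .cons ⟨by simp, by simp, h.1⟩ ((ih h.2).imp fun a b ⟨h1, h2, h3⟩ =>
        ⟨List.mem_cons_of_mem _ h1, List.mem_cons_of_mem _ h2, h3⟩)

theorem forall₂_mem_zip {α β : Type*} {s : List α} {t : List β} (h : s.length = t.length) :
    List.Forall₂ (fun a b => (a, b) ∈ s.zip t) s t := by
  induction s generalizing t with
  | nil => cases t <;> simp at h ⊢
  | cons a s ih =>
    cases t with
    | nil => simp at h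
    | cons b t =>
      simp only [List.length_cons, add_left_inj] at h
      exact .cons (by simp) ((ih h).imp fun a b hab => by simp [hab])

namespace Saturated

variable {l r : CompOp} {Q₁ Q₂ : Query} {C : Data}

/-- A saturated derivation does not admit a substitution that maps the first query to the second
one modulo known facts, for then the negation of the right semi-interval would be known. -/
theorem exists_rsi_of_subst (h : Saturated l r (encPair Q₁ Q₂) C)
    (hsafe : ∀ a ∈ Q₁.acs, Q₁.OccursInBody a.lhs) (g : ℕ → Term)
    (hg : ∀ n, (Term.var n).enc ∈ subdata (encPair Q₁ Q₂) →
      (g n).enc ∈ subdata (encPair Q₁ Q₂))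
    (hhead : List.Forall₂ (fun s t => KnownEq C (s.subst g).enc t.enc) Q₁.head Q₂.head)
    (hbody : ∀ a ∈ Q₁.body, ∃ b ∈ Q₂.body, a.rel = b.rel ∧
      List.Forall₂ (fun s t => KnownEq C (s.subst g).enc t.enc) a.args b.args)
    (hacs : ∀ c ∈ Q₁.acs, c.op = l → LeIn C (g c.lhs) c.rhs ∧ (l = .lt → NeIn C (g c.lhs) c.rhs)) :
    ∃ c ∈ Q₁.acs, c.op = r ∧ LeIn C (g c.lhs) c.rhs ∧ (r = .ge → NeIn C (g c.lhs) c.rhs) := by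
  have hinj : Function.Injective fun n => (Term.var n).enc := fun m n e => by
    simpa using Term.enc_injective e
  let φ : Data → Data := Function.extend (fun n => (Term.var n).enc) (fun n => (g n).enc) id
  have hφ : ∀ n, φ (Term.var n).enc = (g n).enc := fun n => hinj.extend_apply _ _ n
  have hφS : ∀ u ∈ subdata (encPair Q₁ Q₂), φ u ∈ subdata (encPair Q₁ Q₂) := by
    intro u hu
    by_cases hn : ∃ n, (Term.var n).enc = u
    · obtain ⟨n, rfl⟩ := hn
      rw [hφ]
      exact hg n hu
    · rw [show φ u = u from Function.extend_apply' _ _ _ hn]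
      exact hu
  have hmem : ∀ n, (Term.var n).enc ∈ subdata (encPair Q₁ Q₂) →
      .pair (Term.var n).enc (g n).enc ∈ (hint (encPair Q₁ Q₂) φ).elems := by
    intro n hn
    simp only [hint, elems_encList, List.mem_map]
    exact ⟨_, hn, by rw [hφ]⟩
  have hterm : ∀ s t : Term, s.enc ∈ subdata (encPair Q₁ Q₂) →
      KnownEq C (s.subst g).enc t.enc → MatchTerm (hint (encPair Q₁ Q₂) φ) C s.enc t.enc := by
    rintro (n | c) t hs hst
    · exact Or.inl ⟨rfl, _, hmem n hs, rfl, hst⟩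
    · exact Or.inr ⟨by simp, hst⟩
  have hargs : ∀ s t : List Term, (∀ a ∈ s, a.enc ∈ subdata (encPair Q₁ Q₂)) →
      List.Forall₂ (fun s t => KnownEq C (s.subst g).enc t.enc) s t →
      MatchArgs (hint (encPair Q₁ Q₂) φ) C (encList Term.enc s) (encList Term.enc t) := by
    intro s t hs hst
    rw [matchArgs_encList]
    exact ((List.forall₂_and_left _ _).2 ⟨hs, hst⟩).imp fun a b hab => hterm a b hab.1 hab.2
  have hvar : ∀ c ∈ Q₁.acs, (Term.var c.lhs).enc ∈ subdata (encPair Q₁ Q₂) := fun c hc =>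
    mem_subdata_left (enc_mem_subdata_of_occursInBody (hsafe c hc))
  have hmap : IsMapping l (encPair Q₁ Q₂) (hint (encPair Q₁ Q₂) φ) C := by
    refine ⟨?_, ?_, ?_, ?_⟩
    · simp only [hint, elems_encList, List.mem_map]
      rintro _ ⟨u, -, rfl⟩ _ ⟨u', -, rfl⟩ e
      exact congrArg φ e
    · exact hargs _ _ (fun a ha => mem_subdata_left (enc_mem_subdata_of_mem_head ha)) hhead
    · simp only [encPair, Query.enc, left_pair, right_pair, elems_encList, List.mem_map]
      rintro _ ⟨a, ha, rfl⟩
      obtain ⟨b, hb, e, hab⟩ := hbody a ha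
      refine ⟨_, ⟨b, hb, rfl⟩, by simp [Atom.enc, e], ?_⟩
      exact hargs _ _ (fun t ht => mem_subdata_left (enc_mem_subdata_of_mem_body ha ht)) hab
    · intro c hc hop
      simp only [encPair, Query.enc, left_pair, right_pair, elems_encList, List.mem_map] at hc
      obtain ⟨c, hc, rfl⟩ := hc
      obtain ⟨h1, h2⟩ := hacs c hc (CompOp.enc_injective hop)
      exact ⟨_, hmem c.lhs (hvar c hc), rfl, h1, h2⟩
  have hclosed : ∀ f ∈ factsOn (encPair Q₁ Q₂),
      NegatesRSI r (encPair Q₁ Q₂) (hint (encPair Q₁ Q₂) φ) f → Known C f := fun f hf hn =>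
    h.closed f hf _ (size_hint_le hφS) (Or.inr (Or.inr (Or.inr ⟨hmap, hn⟩)))
  by_cases hr : ∃ c ∈ Q₁.acs, c.op = r
  · obtain ⟨c, hc, hop⟩ := hr
    have hcm : c.enc ∈ (encPair Q₁ Q₂).left.right.right.elems := by
      simpa [encPair, Query.enc] using ⟨c, hc, rfl⟩
    have h1 := hg _ (hvar c hc)
    have h2 : c.rhs.enc ∈ subdata (encPair Q₁ Q₂) := mem_subdata_left (enc_rhs_mem_subdata hc)
    refine ⟨c, hc, hop, hclosed _ (mem_factsOn.2 ⟨_, h1, _, h2, Or.inl rfl⟩) (Or.inl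
      ⟨c.enc, hcm, by rw [← hop]; rfl, _, hmem _ (hvar c hc), rfl, Or.inl rfl⟩), fun hge =>
      hclosed _ (mem_factsOn.2 ⟨_, h1, _, h2, Or.inr rfl⟩) (Or.inl
      ⟨c.enc, hcm, by rw [← hop]; rfl, _, hmem _ (hvar c hc), rfl, Or.inr ⟨hge, rfl⟩⟩)⟩
  · exfalso
    -- Without an RSI the mapping rule yields `a ≠ a` for any `a`; the whole input is a convenient
    -- choice.
    have hx := mem_subdata_self (encPair Q₁ Q₂)
    refine h.irrefl (encPair Q₁ Q₂) (hclosed _ (mem_factsOn.2 ⟨_, hx, _, hx, Or.inr rfl⟩)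
      (Or.inr ⟨fun c hc e => hr ?_, rfl⟩))
    simp only [encPair, Query.enc, left_pair, right_pair, elems_encList, List.mem_map] at hc
    obtain ⟨c, hc, rfl⟩ := hc
    exact ⟨c, hc, CompOp.enc_injective e⟩

variable {D : Type*} [LinearOrder D] {ι : ℚ ↪o D}

/-- An assignment of the first query does not arise from such a substitution. -/
theorem false_of_subst (h : Saturated l r (encPair Q₁ Q₂) C)
    (hsafe : ∀ a ∈ Q₁.acs, Q₁.OccursInBody a.lhs) (hcl : Q₁.InClass l r)
    (hr : r = .ge ∨ r = .gt) {v w : ℕ → D}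
    (hle : ∀ a b, LeIn C a b → a.eval ι v ≤ b.eval ι v)
    (hlt : ∀ a b, LeIn C a b → NeIn C a b → a.eval ι v < b.eval ι v)
    (hw : ∀ c ∈ Q₁.acs, c.Holds ι w) (g : ℕ → Term)
    (hg : ∀ n, (Term.var n).enc ∈ subdata (encPair Q₁ Q₂) →
      (g n).enc ∈ subdata (encPair Q₁ Q₂))
    (hgw : ∀ n, Q₁.OccursInBody n → (g n).eval ι v = w n)
    (hhead : List.Forall₂ (fun s t => KnownEq C (s.subst g).enc t.enc) Q₁.head Q₂.head)
    (hbody : ∀ a ∈ Q₁.body, ∃ b ∈ Q₂.body, a.rel = b.rel ∧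
      List.Forall₂ (fun s t => KnownEq C (s.subst g).enc t.enc) a.args b.args)
    (hacs : ∀ c ∈ Q₁.acs, c.op = l → LeIn C (g c.lhs) c.rhs ∧
      (l = .lt → NeIn C (g c.lhs) c.rhs)) : False := by
  obtain ⟨c, hc, hop, h1, h2⟩ := h.exists_rsi_of_subst hsafe g hg hhead hbody hacs
  have hcw := hw c hc
  have hgc := hgw _ (hsafe c hc)
  obtain ⟨-, d, hd⟩ := hcl.1 c hc
  obtain ⟨X, op, t⟩ := c
  simp only at hd hop hgc h1 h2
  subst hd hop
  have h1' := hle _ _ h1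
  rw [hgc] at h1'
  rcases hr with rfl | rfl
  · have h2' := hlt _ _ h1 (h2 rfl)
    rw [hgc] at h2'
    exact absurd h2' (not_lt.2 hcw)
  · exact absurd hcw (not_lt.2 h1')

/-- Two models are needed. Pinning settles open LSIs but creates underived equalities, so it is used
only when `Q₁` is equation-free; in all other cases the model has no pins. -/
theorem not_contained [DenselyOrdered D] [NoMinOrder D] [NoMaxOrder D]
    (h : Saturated l r (encPair Q₁ Q₂) C) (hQ₁ : Q₁.WellFormed ι) (hQ₂ : Q₂.WellFormed ι)
    (hcl : Q₁.InClass l r) (hside : SideCondition ι Q₁ Q₂) (hl : l = .le ∨ l = .lt)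
    (hr : r = .ge ∨ r = .gt) : ¬ Q₂.Contained ι Q₁ := by
  classical
  rw [contained_iff]
  push Not
  have hhead₁ : ∀ t ∈ Q₁.head, t.enc ∈ subdata (encPair Q₁ Q₂) := fun t ht =>
    mem_subdata_left (enc_mem_subdata_of_mem_head ht)
  have hhead₂ : ∀ t ∈ Q₂.head, t.enc ∈ subdata (encPair Q₁ Q₂) := fun t ht =>
    mem_subdata_right (enc_mem_subdata_of_mem_head ht)
  have hbody₁ : ∀ a ∈ Q₁.body, ∀ t ∈ a.args, t.enc ∈ subdata (encPair Q₁ Q₂) := fun a ha t ht =>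
    mem_subdata_left (enc_mem_subdata_of_mem_body ha ht)
  have hbody₂ : ∀ a ∈ Q₂.body, ∀ t ∈ a.args, t.enc ∈ subdata (encPair Q₁ Q₂) := fun a ha t ht =>
    mem_subdata_right (enc_mem_subdata_of_mem_body ha ht)
  have hocc : ∀ n, Q₁.OccursInBody n → (Term.var n).enc ∈ subdata (encPair Q₁ Q₂) :=
    fun n ⟨a, ha, hn⟩ => hbody₁ a ha _ hn
  have hrhs : ∀ c ∈ Q₁.acs, c.rhs.enc ∈ subdata (encPair Q₁ Q₂) := fun c hc =>
    mem_subdata_left (enc_rhs_mem_subdata hc)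
  by_cases hcase : l = .lt ∧ Q₁.EquationFree
  · obtain ⟨rfl, xs, hnodup, hxs⟩ := hcase
    -- Every term that could violate an open LSI at `c` without contradicting the derivation is
    -- pushed up to `c`. A value below `c` is then proof that `≠ c` was derived.
    let P : Term → ℚ → Prop := fun y c => Q₁.OpenLSIConst c ∧ LeIn C y (.const c) ∧
      ¬ NeIn C y (.const c)
    obtain ⟨v, hv, hle, hlt, -, hpin, hconst⟩ := h.exists_model ι hQ₂ (P := P)
      (fun y c hy => hy.2) (by
        intro X Y hXY hn y z c hy hz hyX hXc hzY hYc
        have hc := h.mem_right hXc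
        have hnX : ¬ NeIn C (.var X) (.const c) := fun hnX =>
          hy.2.2 (h.ne_of_between hnX hyX hXc hy.2.1 (h.le_refl hc))
        have hnY : ¬ NeIn C (.var Y) (.const c) := fun hnY =>
          hz.2.2 (h.ne_of_between hnY hzY hYc hz.2.1 (h.le_refl hc))
        have hrsi : r = .gt → ¬ Q₁.OpenRSIConst c := fun _ => hside.ne_shared X Y hXY c hy.1
        refine hside.ne_closed X Y hXY c (Or.inl hy.1)
          ⟨Or.inl (h.closedLSI hQ₂ hcl hr hXc hnX (fun hcX => ?_) hrsi),
            Or.inl (h.closedLSI hQ₂ hcl hr hYc hnY (fun hcY => ?_) hrsi)⟩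
        · have hYX := h.le_trans hYc hcX
          exact hnY (h.ne_of_between (h.ne_symm hn hYX) (h.le_refl (h.mem_left hYc)) hYc hYX hXc)
        · have hXY' := h.le_trans hXc hcY
          exact hnX (h.ne_of_between hn (h.le_refl (h.mem_left hXc)) hXc hXY' hYc))
    refine ⟨v, hv, ?_⟩
    rintro ⟨w, hbody, hw, hhead⟩
    choose! b hb hbe using hbody
    have hlen : ∀ a ∈ Q₁.body, a.args.length = (b a).args.length := fun a ha => by
      simpa [Atom.fact] using (congrArg (fun φ => φ.2.length) (hbe a ha)).symm
    have hlen' : Q₁.head.length = Q₂.head.length := by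
      simpa using (congrArg List.length hhead).symm
    -- All pairs of matched positions. The first components are distinct variables, so `Z` is the
    -- graph of a substitution that hits the terms of `Q₂` exactly, and no equality from the pinned
    -- model is needed.
    let Z : List (Term × Term) := Q₁.head.zip Q₂.head ++
      Q₁.body.flatMap fun a => a.args.zip (b a).args
    have hZ : Z.map Prod.fst = xs.map Term.var := by
      rw [← hxs]
      simp only [Z, List.map_append, List.map_fst_zip hlen'.le, List.map_flatMap]
      congr 1
      simp only [List.flatMap]
      congr 1
      exact List.map_congr_left fun a ha => List.map_fst_zip (hlen a ha).le
    have hfun : ∀ p ∈ Z, ∀ q ∈ Z, p.1 = q.1 → p = q := fun p hp q hq e =>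
      List.inj_on_of_nodup_map (hZ ▸ hnodup.map fun m n e => by simpa using e) hp hq e
    have hZw : ∀ p ∈ Z, p.1.eval ι w = p.2.eval ι v ∧
        p.2.enc ∈ subdata (encPair Q₁ Q₂) := by
      have hzip : ∀ (s t : List Term), s.map (Term.eval ι w) = t.map (Term.eval ι v) →
          ∀ p ∈ s.zip t, p.1.eval ι w = p.2.eval ι v := by
        intro s t hst p hp
        exact (List.forall₂_iff_zip.1 (forall₂_of_map_eq hst)).2 hp |>.2.2
      intro p hp
      rcases List.mem_append.1 hp with hp | hp
      · exact ⟨hzip _ _ hhead.symm p hp, hhead₂ _ (List.of_mem_zip hp).2⟩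
      · obtain ⟨a, ha, hp⟩ := List.mem_flatMap.1 hp
        exact ⟨hzip _ _ (congrArg Prod.snd (hbe a ha)).symm p hp,
          hbody₂ _ (hb a ha) _ (List.of_mem_zip hp).2⟩
    let g : ℕ → Term := fun n => if hn : ∃ t, (Term.var n, t) ∈ Z then hn.choose else .var n
    have hgZ : ∀ s t, (s, t) ∈ Z → s.subst g = t := by
      intro s t hst
      have hs : s ∈ Z.map Prod.fst := List.mem_map.2 ⟨_, hst, rfl⟩
      rw [hZ, List.mem_map] at hs
      obtain ⟨n, -, rfl⟩ := hs
      have hn : ∃ t, (Term.var n, t) ∈ Z := ⟨t, hst⟩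
      simp only [Term.subst, g, dif_pos hn]
      exact congrArg Prod.snd (hfun _ hn.choose_spec _ hst rfl)
    have hEq : ∀ s t, (s, t) ∈ Z → KnownEq C (s.subst g).enc t.enc := by
      intro s t hst
      rw [hgZ s t hst]
      exact ⟨h.le_refl (hZw _ hst).2, h.le_refl (hZw _ hst).2⟩
    have hgmem : ∀ n, (Term.var n).enc ∈ subdata (encPair Q₁ Q₂) →
        (g n).enc ∈ subdata (encPair Q₁ Q₂) := by
      intro n hn
      by_cases hn' : ∃ t, (Term.var n, t) ∈ Z
      · simp only [g, dif_pos hn']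
        exact (hZw _ hn'.choose_spec).2
      · simpa only [g, dif_neg hn'] using hn
    have hbodyZ : ∀ a ∈ Q₁.body, ∀ p ∈ a.args.zip (b a).args, p ∈ Z := fun a ha p hp =>
      List.mem_append_right _ (List.mem_flatMap.2 ⟨a, ha, hp⟩)
    have hgw : ∀ n, Q₁.OccursInBody n → (g n).eval ι v = w n := by
      rintro n ⟨a, ha, hn⟩
      rw [← List.map_fst_zip (hlen a ha).le] at hn
      obtain ⟨⟨s, t⟩, hp, e⟩ := List.mem_map.1 hn
      obtain rfl : s = .var n := e
      have h1 := hgZ _ _ (hbodyZ a ha _ hp)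
      have h2 := (hZw _ (hbodyZ a ha _ hp)).1
      simp only [Term.subst] at h1
      rw [h1, ← h2, Term.eval]
    refine h.false_of_subst hQ₁.lhs_safe hcl hr hle hlt hw g hgmem hgw
      ((forall₂_mem_zip hlen').imp fun s t hst => hEq s t (List.mem_append_left _ hst))
      (fun a ha => ⟨b a, hb a ha, (congrArg Prod.fst (hbe a ha)).symm,
        (forall₂_mem_zip (hlen a ha)).imp fun s t hst => hEq s t (hbodyZ a ha _ hst)⟩)
      (fun c hc hop => ?_)
    have hcw := hw c hc
    have hgc := hgw _ (hQ₁.lhs_safe c hc)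
    have hgm := hgmem _ (hocc _ (hQ₁.lhs_safe c hc))
    have hcm := hrhs c hc
    obtain ⟨-, d, hd⟩ := hcl.1 c hc
    obtain ⟨X, op, t⟩ := c
    simp only at hd hop hgc hgm hcm ⊢
    subst hd hop
    have hcw : w X < ι d := hcw
    rw [← hgc] at hcw
    have hXd := hconst _ _ hgm hcm hcw.le
    refine ⟨hXd, fun _ => ?_⟩
    by_contra hn
    exact absurd hcw (not_lt.2 (hpin (.const d) (g X) d
      (Or.inr ⟨d, g X, ⟨⟨X, hc⟩, hXd, hn⟩, h.le_refl hcm, h.le_refl hgm⟩) rfl hgm))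
  · obtain ⟨v, hv, hle, hlt, hinj, -, hconst⟩ := h.exists_model ι hQ₂ (P := fun _ _ => False)
      (by simp) (by simp)
    have hEq : ∀ a b : Term, a.enc ∈ subdata (encPair Q₁ Q₂) →
        b.enc ∈ subdata (encPair Q₁ Q₂) → a.eval ι v = b.eval ι v → KnownEq C a.enc b.enc := by
      have hLe : ∀ a b : Term, a.enc ∈ subdata (encPair Q₁ Q₂) →
          b.enc ∈ subdata (encPair Q₁ Q₂) → a.eval ι v = b.eval ι v → LeIn C a b :=
        fun a b ha hb e => (hinj a b ha hb e).resolve_right (by simp)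
      exact fun a b ha hb e => ⟨hLe a b ha hb e, hLe b a hb ha e.symm⟩
    refine ⟨v, hv, ?_⟩
    rintro ⟨w, hbody, hw, hhead⟩
    -- Any input term with the right value will do, because in the generic model equal values mean
    -- derived equality. The default `.var n` keeps the hint within the data of the input.
    let g : ℕ → Term := fun n => if hn : ∃ t : Term, t.enc ∈ subdata (encPair Q₁ Q₂) ∧
      t.eval ι v = w n then hn.choose else .var n
    have hgmem : ∀ n, (Term.var n).enc ∈ subdata (encPair Q₁ Q₂) →
        (g n).enc ∈ subdata (encPair Q₁ Q₂) := by
      intro n hn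
      by_cases hn' : ∃ t : Term, t.enc ∈ subdata (encPair Q₁ Q₂) ∧ t.eval ι v = w n
      · simp only [g, dif_pos hn']
        exact hn'.choose_spec.1
      · simpa only [g, dif_neg hn'] using hn
    have hgw : ∀ n, Q₁.OccursInBody n → (g n).eval ι v = w n := by
      rintro n ⟨a, ha, hn⟩
      obtain ⟨b, hb, e⟩ := hbody a ha
      have hmem : w n ∈ b.args.map (Term.eval ι v) := by
        have e' : b.args.map (Term.eval ι v) = a.args.map (Term.eval ι w) := congrArg Prod.snd e
        rw [e']
        exact List.mem_map.2 ⟨_, hn, rfl⟩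
      obtain ⟨t, ht, htw⟩ := List.mem_map.1 hmem
      have hn' : ∃ t : Term, t.enc ∈ subdata (encPair Q₁ Q₂) ∧ t.eval ι v = w n :=
        ⟨t, hbody₂ b hb t ht, htw⟩
      simp only [g, dif_pos hn']
      exact hn'.choose_spec.2
    have hterm : ∀ s t : Term, s.enc ∈ subdata (encPair Q₁ Q₂) →
        t.enc ∈ subdata (encPair Q₁ Q₂) → (∀ n, s = .var n → Q₁.OccursInBody n) →
        s.eval ι w = t.eval ι v → KnownEq C (s.subst g).enc t.enc := by
      intro s t hs ht hsb e
      refine hEq _ _ ?_ ht ?_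
      · cases s
        · exact hgmem _ hs
        · exact hs
      · rw [← e]
        exact Term.eval_subst fun n hn => hgw n (hsb n hn)
    refine h.false_of_subst hQ₁.lhs_safe hcl hr hle hlt hw g hgmem hgw
      ((forall₂_of_map_eq hhead.symm).imp fun s t ⟨hs, ht, e⟩ => hterm s t (hhead₁ s hs)
        (hhead₂ t ht) (fun n hn => hQ₁.head_safe n (hn ▸ hs)) e)
      (fun a ha => ?_) (fun c hc hop => ?_)
    · obtain ⟨b, hb, e⟩ := hbody a ha
      exact ⟨b, hb, (congrArg Prod.fst e).symm, (forall₂_of_map_eq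
        (congrArg Prod.snd e).symm).imp fun s t ⟨hs, ht, e⟩ => hterm s t (hbody₁ a ha s hs)
          (hbody₂ b hb t ht) (fun n hn => ⟨a, ha, hn ▸ hs⟩) e⟩
    · have hcw := hw c hc
      have hgc := hgw _ (hQ₁.lhs_safe c hc)
      have hgm := hgmem _ (hocc _ (hQ₁.lhs_safe c hc))
      have hcm := hrhs c hc
      obtain ⟨-, d, hd⟩ := hcl.1 c hc
      obtain ⟨X, op, t⟩ := c
      simp only at hd hop hgc hgm hcm ⊢
      subst hd hop
      rcases hl with rfl | rfl
      · have hcw : w X ≤ ι d := hcw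
        rw [← hgc] at hcw
        exact ⟨hconst _ _ hgm hcm hcw, fun e => by simp at e⟩
      · have hcw : w X < ι d := hcw
        rw [← hgc] at hcw
        have hXd := hconst _ _ hgm hcm hcw.le
        refine ⟨hXd, fun _ => ?_⟩
        by_contra hn
        -- If `g X ≠ d` is underivable, a variable `g X` gives a forbidden closed LSI, while a
        -- constant `g X` must be `d`, against `w X < d`.
        have hnorm := hside.normalization (fun he => hcase ⟨rfl, he⟩) d ⟨X, hc⟩
        rcases hgX : g X with Y | k
        · rw [hgX] at hXd hn hcw
          refine hnorm.2 Y (h.closedLSI hQ₂ hcl hr hXd hn (fun hdY => ?_) fun _ => hnorm.1)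
          exact absurd hcw (not_lt.2 (hle _ _ hdY))
        · rw [hgX] at hXd hn hcw
          obtain rfl := h.const_eq_of_between hn (h.le_refl (h.mem_left hXd)) hXd
          exact lt_irrefl _ hcw

end Saturated

theorem containmentProblem_inNP {D : Type*} [LinearOrder D] [DenselyOrdered D] [NoMinOrder D]
    [NoMaxOrder D] (ι : ℚ ↪o D) {l r : CompOp} (hl : l = .le ∨ l = .lt)
    (hr : r = .ge ∨ r = .gt) : (containmentProblem ι l r).InNP := by
  obtain ⟨L, hL, hmem⟩ := exists_NP (PTP.isRefutation l r) derivationBound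
  refine ⟨L, hL, ?_⟩
  rintro ⟨⟨Q₁, Q₂⟩, hQ₁, hQ₂, hcl, hside⟩
  refine (hmem (encPair Q₁ Q₂)).trans ⟨?_, fun h => ?_⟩
  · rintro ⟨C, -, hC⟩
    exact hC.contained hcl hl hr
  · refine (exists_refutation_or_saturated l r (encPair Q₁ Q₂)).resolve_right ?_
    rintro ⟨C, hC⟩
    exact hC.not_contained hQ₁ hQ₂ hcl hside hl hr h

end CQAC

theorem mainTheorem9 {D : Type*} [LinearOrder D] [DenselyOrdered D] [NoMinOrder D] [NoMaxOrder D]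
    (ι : ℚ ↪o D) :
    (CQAC.containmentProblem ι .le .ge).InNP ∧
    (CQAC.containmentProblem ι .le .gt).InNP ∧
    (CQAC.containmentProblem ι .lt .ge).InNP ∧
    (CQAC.containmentProblem ι .lt .gt).InNP :=
  ⟨CQAC.containmentProblem_inNP ι (.inl rfl) (.inl rfl),
    CQAC.containmentProblem_inNP ι (.inl rfl) (.inr rfl),
    CQAC.containmentProblem_inNP ι (.inr rfl) (.inl rfl),
    CQAC.containmentProblem_inNP ι (.inr rfl) (.inr rfl)⟩
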